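/- "Manifold" means a $C^\infty$, real analytic or complex manifold, $\mathcal O_X$ is the sheaf of real or complex valued $C^\infty$, respectively real analytic, or of holomorphic functions, and $\mathcal T_X$, $\Omega^1_X$ are the sheaves of vector fields and $1$-forms with coefficients in $\mathcal O_X$. Let $\mathcal Q$ be a Courant algebroid on $X$, locally free of finite rank over $\mathcal O_X$, with anchor $\pi\colon\mathcal Q\to\mathcal T_X$, co-anchor $\pi^\dagger\colon\Omega^1_X\to\mathcal Q$, Leibniz bracket $\{\ ,\ \}$ and symmetric, not necessarily non-degenerate, pairing $\langle\ ,\ \rangle$, subject to $\pi\pi^\dagger=0$, $\{q_1,fq_2\}=f\{q_1,q_2\}+\pi(q_1)(f)q_2$, $\langle\{q,q_1\},q_2\rangle+\langle q_1,\{q,q_2\}\rangle=\pi(q)\langle q_1,q_2\rangle$, $\{q,\pi^\dagger\alpha\}=\pi^\dagger(L_{\pi(q)}\alpha)$, $\langle q,\pi^\dagger\alpha\rangle=\iota_{\pi(q)}\alpha$, $\{q_1,q_2\}+\{q_2,q_1\}=\pi^\dagger d\langle q_1,q_2\rangle$. Let $i\colon Z\to X$ be an (embedded) submanifold. An *almost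 Dirac structure in $\mathcal Q$ supported on $Z$* is a sub-bundle $\mathcal K\subset i^*\mathcal Q$ whose fibres are maximal isotropic subspaces and which is mapped to $\mathcal T_Z\subset i^*\mathcal T_X$ by $\pi$. It is a *Dirac structure supported on $Z$* if, moreover, the sheaf of sections of $\mathcal Q$ whose restriction to $Z$ lies in $\mathcal K$ is closed under the bracket. For $Z=X$ one speaks of (almost) Dirac structures in $\mathcal Q$. Let $\mathcal N^\vee_{Z|X}=\ker(i^*\Omega^1_X\to\Omega^1_Z)$ be the conormal bundle and $$i^{++}\mathcal Q=(\mathcal T_Z\times_{i^*\mathcal T_X}i^*\mathcal Q)/\pi^\dagger(\mathcal N^\vee_{Z|X}),$$ with the pairing, anchor, co-anchor and bracket induced from $\mathcal Q$: the bracket of two sections is the class of the restriction to $Z$ of the bracket of any lifts of them to local sections of $\mathcal Q$. Assume that $\mathcal T_Z\times_{i^*\mathcal T_X}i^*\mathcal Q$ and $\pi^\dagger(\mathcal N^\vee_{Z|X})\subset i^*\mathcal Q$ have locally constant rank (i.e. the dimensions of their fibres $\{(\xi,v)\in \mathcal T_{Z,z}\times\mathcal Q_{i(z)} : di(\xi)=\pi(v)\}$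 and $\pi^\dagger(\mathcal N^\vee_{Z|X,z})$ are locally constant in $z\in Z$), so that $i^{++}\mathcal Q$ is locally free of finite rank. **Proposition.** (1) If $\mathcal K$ is a Dirac structure in $\mathcal Q$ supported on $Z$, then $\pi^\dagger(\mathcal N^\vee_{Z|X})\subset\mathcal K$ and $i^{++}\mathcal K=\mathcal K/\pi^\dagger(\mathcal N^\vee_{Z|X})$ is a Dirac structure in $i^{++}\mathcal Q$. (2) The assignment $\mathcal K\mapsto i^{++}\mathcal K$ is a bijection between Dirac structures in $\mathcal Q$ supported on $Z$ and Dirac structures in $i^{++}\mathcal Q$, and also a bijection between almost Dirac structures in $\mathcal Q$ supported on $Z$ and almost Dirac structures in $i^{++}\mathcal Q$. -/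

import Mathlib

open Set Filter Topology Module
open scoped Manifold ContDiff

noncomputable section

namespace CourantDirac

/-! ### Functions, `1`-forms and vector fields

`X` is a manifold over the field `𝕜`, and `𝕂` is the field of coefficients: `𝕜 = 𝕂 = ℝ` or `𝕜 = ℝ`,
`𝕂 = ℂ` give real or complex valued functions on a real manifold, `𝕜 = 𝕂 = ℂ` holomorphic functions
on a complex manifold. The order of differentiability `n` is `∞` or `ω`.
All sheaves are handled through germs: a local section near `x` is represented by a
function defined everywhere, of which only the germ at `x` matters. -/

section Basic

variable (𝕜 : Type*) [RCLike 𝕜] {𝕂 : Type*} [RCLike 𝕂] [NormedAlgebra 𝕜 𝕂]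
  (E : Type*) [NormedAddCommGroup E] [NormedSpace 𝕜 E] (n : WithTop ℕ∞)
  {X : Type*} [TopologicalSpace X] [ChartedSpace E X]

/-- `f` is a section of the structure sheaf `𝒪_X` near `x`. -/
def IsFun (f : X → 𝕂) (x : X) : Prop :=
  ∀ᶠ y in 𝓝 x, ContMDiffAt 𝓘(𝕜, E) 𝓘(𝕜, 𝕂) n f y

variable (𝕂) in
/-- The fibre of `Ω¹_X` at `x`: the space of `𝕜`-linear maps `T_x X → 𝕂`. -/
def Cot (x : X) : Type _ := TangentSpace 𝓘(𝕜, E) x →L[𝕜] 𝕂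

instance (x : X) : AddCommGroup (Cot 𝕜 𝕂 E x) :=
  inferInstanceAs (AddCommGroup (TangentSpace 𝓘(𝕜, E) x →L[𝕜] 𝕂))

instance (x : X) : Module 𝕂 (Cot 𝕜 𝕂 E x) :=
  inferInstanceAs (Module 𝕂 (TangentSpace 𝓘(𝕜, E) x →L[𝕜] 𝕂))

variable (𝕂) in
/-- The fibre of `𝒯_X` at `x`, the space `𝕂 ⊗_𝕜 T_x X`, realised as the `𝕂`-dual of the fibre
of `Ω¹_X` (the tangent spaces are finite-dimensional wherever this is used). -/
def Tan (x : X) : Type _ := Cot 𝕜 𝕂 E x →ₗ[𝕂] 𝕂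

instance (x : X) : AddCommGroup (Tan 𝕜 𝕂 E x) := inferInstanceAs (AddCommGroup (Cot 𝕜 𝕂 E x →ₗ[𝕂] 𝕂))

instance (x : X) : Module 𝕂 (Tan 𝕜 𝕂 E x) := inferInstanceAs (Module 𝕂 (Cot 𝕜 𝕂 E x →ₗ[𝕂] 𝕂))

instance (x : X) : FunLike (Tan 𝕜 𝕂 E x) (Cot 𝕜 𝕂 E x) 𝕂 :=
  inferInstanceAs (FunLike (Cot 𝕜 𝕂 E x →ₗ[𝕂] 𝕂) (Cot 𝕜 𝕂 E x) 𝕂)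

instance (x : X) : LinearMapClass (Tan 𝕜 𝕂 E x) 𝕂 (Cot 𝕜 𝕂 E x) 𝕂 :=
  inferInstanceAs (LinearMapClass (Cot 𝕜 𝕂 E x →ₗ[𝕂] 𝕂) 𝕂 (Cot 𝕜 𝕂 E x) 𝕂)

/-- The differential `df` of a `𝕂`-valued function. -/
def dif (f : X → 𝕂) (x : X) : Cot 𝕜 𝕂 E x := mvfderiv 𝓘(𝕜, E) f x

/-- The function `ξ(f) = ⟨ξ, df⟩`. -/
def der (ξ : ∀ x : X, Tan 𝕜 𝕂 E x) (f : X → 𝕂) (x : X) : 𝕂 := ξ x (dif 𝕜 E f x)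

/-- `α` is a section of `Ω¹_X` near `x`, i.e. `α = ∑ g_j df_j` with functions `g_j`, `f_j`. -/
def IsForm (α : ∀ x : X, Cot 𝕜 𝕂 E x) (x : X) : Prop :=
  ∃ (r : ℕ) (g f : Fin r → X → 𝕂), (∀ j, IsFun 𝕜 E n (g j) x) ∧ (∀ j, IsFun 𝕜 E n (f j) x) ∧
    ∀ᶠ y in 𝓝 x, α y = ∑ j, g j y • dif 𝕜 E (f j) y

/-- `ξ` is a section of `𝒯_X` near `x`, i.e. it maps local functions to local functions. -/
def IsVec (ξ : ∀ x : X, Tan 𝕜 𝕂 E x) (x : X) : Prop :=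
  ∀ᶠ y in 𝓝 x, ∀ f : X → 𝕂, IsFun 𝕜 E n f y → IsFun 𝕜 E n (der 𝕜 E ξ f) y

/-- `β` is the Lie derivative `L_ξ α` near `x`: if `α = ∑ g_j df_j`, then
`L_ξ α = ∑ (ξ(g_j) df_j + g_j d(ξ(f_j)))`. -/
def IsLieDeriv (ξ : ∀ x : X, Tan 𝕜 𝕂 E x) (α β : ∀ x : X, Cot 𝕜 𝕂 E x) (x : X) : Prop :=
  ∃ (r : ℕ) (g f : Fin r → X → 𝕂), (∀ j, IsFun 𝕜 E n (g j) x) ∧ (∀ j, IsFun 𝕜 E n (f j) x) ∧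
    (∀ᶠ y in 𝓝 x, α y = ∑ j, g j y • dif 𝕜 E (f j) y) ∧
    ∀ᶠ y in 𝓝 x, β y =
      ∑ j, (der 𝕜 E ξ (g j) y • dif 𝕜 E (f j) y + g j y • dif 𝕜 E (der 𝕜 E ξ (f j)) y)

variable (E' : Type*) [NormedAddCommGroup E'] [NormedSpace 𝕜 E']
  {Z : Type*} [TopologicalSpace Z] [ChartedSpace E' Z]

variable (𝕂) in
/-- The pull-back `(di)^∨ : Ω¹_{X, i(z)} → Ω¹_{Z, z}` of covectors. -/
def codiff (i : Z → X) (z : Z) : Cot 𝕜 𝕂 E (i z) →ₗ[𝕂] Cot 𝕜 𝕂 E' z where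
  toFun α := ContinuousLinearMap.comp (M₂ := TangentSpace 𝓘(𝕜, E) (i z)) (M₃ := 𝕂) α
    (mfderiv 𝓘(𝕜, E') 𝓘(𝕜, E) i z)
  map_add' _ _ := rfl
  map_smul' _ _ := rfl

variable (𝕂) in
/-- The differential `di : 𝒯_{Z, z} → 𝒯_{X, i(z)}`. -/
def diff (i : Z → X) (z : Z) : Tan 𝕜 𝕂 E' z →ₗ[𝕂] Tan 𝕜 𝕂 E (i z) where
  toFun ξ := LinearMap.comp (M₂ := Cot 𝕜 𝕂 E' z) (M₃ := 𝕂) ξ (codiff 𝕜 𝕂 E E' i z)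
  map_add' _ _ := rfl
  map_smul' _ _ := rfl

variable (𝕂) in
/-- The fibre of the conormal bundle `N^∨_{Z|X} = ker ((di)^∨ : i^*Ω¹_X → Ω¹_Z)`. -/
def conormal (i : Z → X) (z : Z) : Submodule 𝕂 (Cot 𝕜 𝕂 E (i z)) :=
  LinearMap.ker (codiff 𝕜 𝕂 E E' i z)

variable {E E'} in
theorem codiff_surjective [FiniteDimensional 𝕜 E] [IsManifold 𝓘(𝕜, E) n X]
    [IsManifold 𝓘(𝕜, E') n Z] (hn : ∞ ≤ n) {i : Z → X}
    (hi : Manifold.IsImmersion 𝓘(𝕜, E') 𝓘(𝕜, E) n i) (z : Z) :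
    Function.Surjective (codiff 𝕜 𝕂 E E' i z) := by
  have hn0 : n ≠ 0 := fun h => by simp [h] at hn
  have hz := hi.isImmersionAt z
  have hφ := hz.domChart_mem_maximalAtlas
  have hψ := hz.codChart_mem_maximalAtlas
  have hzφ := hz.mem_domChart_source
  have hzψ := hz.mem_codChart_source
  have hφd : hz.domChart.MDifferentiable 𝓘(𝕜, E') 𝓘(𝕜, E') :=
    ⟨(contMDiffOn_of_mem_maximalAtlas hφ).mdifferentiableOn hn0,
      (contMDiffOn_symm_of_mem_maximalAtlas hφ).mdifferentiableOn hn0⟩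
  have hid : MDifferentiableAt 𝓘(𝕜, E') 𝓘(𝕜, E) i z := hi.contMDiff.mdifferentiable hn0 z
  let p : E → E' := fun e => (hz.equiv.symm e).1
  have hp : MDifferentiable 𝓘(𝕜, E) 𝓘(𝕜, E') p :=
    ((ContinuousLinearMap.fst 𝕜 E' hz.complement).comp
      (hz.equiv.symm : E →L[𝕜] E' × hz.complement)).differentiable.mdifferentiable
  have hψd : MDifferentiableAt 𝓘(𝕜, E) 𝓘(𝕜, E) hz.codChart (i z) :=
    (contMDiffAt_of_mem_maximalAtlas hψ hzψ).mdifferentiableAt hn0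
  have heq : (p ∘ hz.codChart) ∘ i =ᶠ[𝓝 z] hz.domChart := by
    filter_upwards [hz.domChart.open_source.mem_nhds hzφ] with w hw
    have h := hz.writtenInCharts
      (show hz.domChart w ∈ (hz.domChart.extend 𝓘(𝕜, E')).target by
        simpa [OpenPartialHomeomorph.extend] using hz.domChart.map_source hw)
    simp only [Function.comp_apply, OpenPartialHomeomorph.extend, mfld_simps] at h
    simp [p, hw] at h ⊢
    simp [h]
  have hder := heq.mfderiv_eq (I := 𝓘(𝕜, E')) (I' := 𝓘(𝕜, E'))
  rw [mfderiv_comp z ((hp _).comp _ hψd) hid] at hder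
  have hinj : Function.Injective (mfderiv 𝓘(𝕜, E') 𝓘(𝕜, E) i z) := by
    have h := hφd.mfderiv_injective hzφ
    rw [← hder] at h
    exact Function.Injective.of_comp h
  let L : E' →ₗ[𝕜] E := (mfderiv 𝓘(𝕜, E') 𝓘(𝕜, E) i z).toLinearMap
  obtain ⟨g, hg⟩ := LinearMap.exists_leftInverse_of_injective L (LinearMap.ker_eq_bot.2 hinj)
  let G : E →L[𝕜] E' := LinearMap.toContinuousLinearMap g
  intro β
  refine ⟨ContinuousLinearMap.comp (M₁ := E) (M₂ := E') (M₃ := 𝕂) β G, ?_⟩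
  refine ContinuousLinearMap.ext fun v => ?_
  exact congrArg (fun w : E' => (show E' →L[𝕜] 𝕂 from β) w) (LinearMap.congr_fun hg v)

end Basic

/-! ### Vector bundles as locally free sheaves -/

/-- A family of `𝕂`-vector spaces over `X` together with the specification of those families of
vectors which are sections near a given point. -/
structure ModFamily (𝕂 : Type*) [RCLike 𝕂] (X : Type*) where
  Fiber : X → Type*
  [addCommGroup : ∀ x, AddCommGroup (Fiber x)]
  [module : ∀ x, Module 𝕂 (Fiber x)]
  IsSec : (∀ x, Fiber x) → X → Prop

attribute [instance] ModFamily.addCommGroup ModFamily.module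

namespace ModFamily

variable (𝕜 : Type*) [RCLike 𝕜] {𝕂 : Type*} [RCLike 𝕂] [NormedAlgebra 𝕜 𝕂]
  (E : Type*) [NormedAddCommGroup E] [NormedSpace 𝕜 E] (n : WithTop ℕ∞)
  {X : Type*} [TopologicalSpace X] [ChartedSpace E X]
  (E' : Type*) [NormedAddCommGroup E'] [NormedSpace 𝕜 E']
  {Z : Type*} [TopologicalSpace Z] [ChartedSpace E' Z]

/-- `e` is a frame over `U`: it is a basis of each fibre, and the sections are the combinations of
the `e_j` with coefficients in the structure sheaf. -/
def IsFrame (S : ModFamily 𝕂 X) (U : Set X) {r : ℕ} (e : Fin r → ∀ x, S.Fiber x) : Prop :=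
  (∀ x ∈ U, LinearIndependent 𝕂 (fun j => e j x) ∧
    Submodule.span 𝕂 (Set.range fun j => e j x) = ⊤) ∧
  ∀ x ∈ U, ∀ s, S.IsSec s x ↔
    ∃ c : Fin r → X → 𝕂, (∀ j, IsFun 𝕜 E n (c j) x) ∧ ∀ᶠ y in 𝓝 x, s y = ∑ j, c j y • e j y

/-- `S` is a locally free `𝒪_X`-module of finite rank. -/
def IsLocallyFree (S : ModFamily 𝕂 X) : Prop :=
  ∀ x, ∃ U : Set X, IsOpen U ∧ x ∈ U ∧ ∃ (r : ℕ) (e : Fin r → ∀ x, S.Fiber x), S.IsFrame 𝕜 E n U e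

/-- `K` is a sub-bundle of `S`: it is locally spanned by a part of a frame of `S`. -/
def IsSubbundle (S : ModFamily 𝕂 X) (K : ∀ x, Submodule 𝕂 (S.Fiber x)) : Prop :=
  ∀ x, ∃ U : Set X, IsOpen U ∧ x ∈ U ∧ ∃ (r : ℕ) (e : Fin r → ∀ x, S.Fiber x) (J : Set (Fin r)),
    S.IsFrame 𝕜 E n U e ∧ ∀ y ∈ U, K y = Submodule.span 𝕂 ((fun j => e j y) '' J)

/-- The inverse image `i^*S`: its sections are locally of the form `∑ c_j ⊗ q_j` with functions
`c_j` on `Z` and sections `q_j` of `S`. -/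
def pullback (i : Z → X) (S : ModFamily 𝕂 X) : ModFamily 𝕂 Z where
  Fiber z := S.Fiber (i z)
  IsSec σ z := ∃ (r : ℕ) (c : Fin r → Z → 𝕂) (q : Fin r → ∀ x, S.Fiber x),
    (∀ j, IsFun 𝕜 E' n (c j) z) ∧ (∀ j, S.IsSec (q j) (i z)) ∧
      ∀ᶠ w in 𝓝 z, σ w = ∑ j, c j w • q j (i w)

end ModFamily

/-! ### Courant algebroids -/

/-- The operations of a Courant algebroid on `X`. The bracket is only meaningful on
sections, and its value at `x` only depends on the germs at `x` (see `IsCourant`). -/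
structure CourantOps (𝕜 : Type*) [RCLike 𝕜] (𝕂 : Type*) [RCLike 𝕂] [NormedAlgebra 𝕜 𝕂]
    (E : Type*) [NormedAddCommGroup E] [NormedSpace 𝕜 E]
    (X : Type*) [TopologicalSpace X] [ChartedSpace E X] extends ModFamily 𝕂 X where
  /-- the bracket `{ , }` -/
  bracket : (∀ x, Fiber x) → (∀ x, Fiber x) → ∀ x, Fiber x
  /-- the anchor `π` -/
  anchor : ∀ x, Fiber x →ₗ[𝕂] Tan 𝕜 𝕂 E x
  /-- the pairing `⟨ , ⟩` -/
  pairing : ∀ x, Fiber x →ₗ[𝕂] Fiber x →ₗ[𝕂] 𝕂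
  /-- the co-anchor `π^†` -/
  coanchor : ∀ x, Cot 𝕜 𝕂 E x →ₗ[𝕂] Fiber x

namespace CourantOps

section

variable {𝕜 : Type*} [RCLike 𝕜] {𝕂 : Type*} [RCLike 𝕂] [NormedAlgebra 𝕜 𝕂] (n : WithTop ℕ∞)
  {E : Type*} [NormedAddCommGroup E] [NormedSpace 𝕜 E]
  {X : Type*} [TopologicalSpace X] [ChartedSpace E X]

/-- The axioms of a Courant algebroid, locally free of finite rank as an `𝒪_X`-module.
The pairing may be degenerate. -/
structure IsCourant (Q : CourantOps 𝕜 𝕂 E X) : Prop where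
  locallyFree : Q.IsLocallyFree 𝕜 E n
  /- the operations are morphisms of sheaves -/
  isSec_bracket : ∀ x q p, Q.IsSec q x → Q.IsSec p x → Q.IsSec (Q.bracket q p) x
  isVec_anchor : ∀ x q, Q.IsSec q x → IsVec 𝕜 E n (fun y => Q.anchor y (q y)) x
  isFun_pairing : ∀ x q p, Q.IsSec q x → Q.IsSec p x →
    IsFun 𝕜 E n (fun y => Q.pairing y (q y) (p y)) x
  isSec_coanchor : ∀ x α, IsForm 𝕜 E n α x → Q.IsSec (fun y => Q.coanchor y (α y)) x
  bracket_congr : ∀ x q q' p p', Q.IsSec q x → Q.IsSec q' x → Q.IsSec p x → Q.IsSec p' x →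
    (∀ᶠ y in 𝓝 x, q y = q' y) → (∀ᶠ y in 𝓝 x, p y = p' y) → Q.bracket q p x = Q.bracket q' p' x
  /- the bracket is a `𝕂`-bilinear Leibniz bracket -/
  bracket_add_left : ∀ x q q' p, Q.IsSec q x → Q.IsSec q' x → Q.IsSec p x →
    Q.bracket (fun y => q y + q' y) p x = Q.bracket q p x + Q.bracket q' p x
  bracket_add_right : ∀ x q p p', Q.IsSec q x → Q.IsSec p x → Q.IsSec p' x →
    Q.bracket q (fun y => p y + p' y) x = Q.bracket q p x + Q.bracket q p' x
  bracket_const_left : ∀ x (c : 𝕂) q p, Q.IsSec q x → Q.IsSec p x →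
    Q.bracket (fun y => c • q y) p x = c • Q.bracket q p x
  bracket_const_right : ∀ x (c : 𝕂) q p, Q.IsSec q x → Q.IsSec p x →
    Q.bracket q (fun y => c • p y) x = c • Q.bracket q p x
  leibniz_identity : ∀ x q₁ q₂ q₃, Q.IsSec q₁ x → Q.IsSec q₂ x → Q.IsSec q₃ x →
    Q.bracket q₁ (Q.bracket q₂ q₃) x =
      Q.bracket (Q.bracket q₁ q₂) q₃ x + Q.bracket q₂ (Q.bracket q₁ q₃) x
  /- the anchor is a morphism of Leibniz algebras: `π{q, p} = [π(q), π(p)]` -/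
  anchor_bracket : ∀ x q p, Q.IsSec q x → Q.IsSec p x → ∀ f : X → 𝕂, IsFun 𝕜 E n f x →
    der 𝕜 E (fun y => Q.anchor y (Q.bracket q p y)) f x =
      der 𝕜 E (fun y => Q.anchor y (q y)) (der 𝕜 E (fun y => Q.anchor y (p y)) f) x -
        der 𝕜 E (fun y => Q.anchor y (p y)) (der 𝕜 E (fun y => Q.anchor y (q y)) f) x
  pairing_symm : ∀ x v w, Q.pairing x v w = Q.pairing x w v
  /- the compatibility conditions -/
  anchor_coanchor : ∀ x α, Q.anchor x (Q.coanchor x α) = 0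
  bracket_smul_right : ∀ x (f : X → 𝕂) q p, IsFun 𝕜 E n f x → Q.IsSec q x → Q.IsSec p x →
    Q.bracket q (fun y => f y • p y) x =
      f x • Q.bracket q p x + der 𝕜 E (fun y => Q.anchor y (q y)) f x • p x
  pairing_invariant : ∀ x q q₁ q₂, Q.IsSec q x → Q.IsSec q₁ x → Q.IsSec q₂ x →
    Q.pairing x (Q.bracket q q₁ x) (q₂ x) + Q.pairing x (q₁ x) (Q.bracket q q₂ x) =
      der 𝕜 E (fun y => Q.anchor y (q y)) (fun y => Q.pairing y (q₁ y) (q₂ y)) x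
  bracket_coanchor : ∀ x q α β, Q.IsSec q x →
    IsLieDeriv 𝕜 E n (fun y => Q.anchor y (q y)) α β x →
      Q.bracket q (fun y => Q.coanchor y (α y)) x = Q.coanchor x (β x)
  pairing_coanchor : ∀ x v α, Q.pairing x v (Q.coanchor x α) = Q.anchor x v α
  bracket_add_bracket : ∀ x q p, Q.IsSec q x → Q.IsSec p x →
    Q.bracket q p x + Q.bracket p q x =
      Q.coanchor x (dif 𝕜 E (fun y => Q.pairing y (q y) (p y)) x)

end

section

variable {𝕜 : Type*} [RCLike 𝕜] {𝕂 : Type*} [RCLike 𝕂] [NormedAlgebra 𝕜 𝕂] (n : WithTop ℕ∞)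
  {E : Type*} [NormedAddCommGroup E] [NormedSpace 𝕜 E]
  {X : Type*} [TopologicalSpace X] [ChartedSpace E X]
  (E' : Type*) [NormedAddCommGroup E'] [NormedSpace 𝕜 E']
  {Z : Type*} [TopologicalSpace Z] [ChartedSpace E' Z]

/-! ### Dirac structures with support -/

/-- Almost Dirac structures in `Q` supported on `i : Z → X`: sub-bundles `K ⊆ i^*Q` which are
(fibrewise) maximal isotropic and are mapped to `𝒯_Z` by the anchor. -/
structure IsAlmostDirac (Q : CourantOps 𝕜 𝕂 E X) (i : Z → X)
    (K : ∀ z, Submodule 𝕂 (Q.Fiber (i z))) : Prop where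
  subbundle : (Q.toModFamily.pullback 𝕜 n E' i).IsSubbundle 𝕜 E' n K
  maximal_isotropic : ∀ z, Maximal (fun L : Submodule 𝕂 (Q.Fiber (i z)) =>
    ∀ v ∈ L, ∀ w ∈ L, Q.pairing (i z) v w = 0) (K z)
  anchor_mem : ∀ z, ∀ v ∈ K z, Q.anchor (i z) v ∈ LinearMap.range (diff 𝕜 𝕂 E E' i z)

/-- Dirac structures in `Q` supported on `i : Z → X`: almost Dirac structures `K` such that the
sheaf of sections of `Q` with restriction to `Z` in `K` is closed under the bracket. -/
structure IsDirac (Q : CourantOps 𝕜 𝕂 E X) (i : Z → X)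
    (K : ∀ z, Submodule 𝕂 (Q.Fiber (i z))) : Prop extends Q.IsAlmostDirac n E' i K where
  bracket_mem : ∀ U : Set X, IsOpen U → ∀ q p : ∀ x, Q.Fiber x,
    (∀ x ∈ U, Q.IsSec q x) → (∀ x ∈ U, Q.IsSec p x) →
    (∀ z, i z ∈ U → q (i z) ∈ K z) → (∀ z, i z ∈ U → p (i z) ∈ K z) →
    ∀ z, i z ∈ U → Q.bracket q p (i z) ∈ K z

/-! ### The inverse image of a Courant algebroid under an embedding -/

/-- The fibre of `𝒯_Z ×_{i^*𝒯_X} i^*Q`. -/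
def fibProd (Q : CourantOps 𝕜 𝕂 E X) (i : Z → X) (z : Z) :
    Submodule 𝕂 (Tan 𝕜 𝕂 E' z × Q.Fiber (i z)) :=
  LinearMap.eqLocus (diff 𝕜 𝕂 E E' i z ∘ₗ LinearMap.fst 𝕂 _ _)
    (Q.anchor (i z) ∘ₗ LinearMap.snd 𝕂 _ _)

/-- `π^†(N^∨_{Z|X})` at `z`, as a subspace of the fibre of `i^*Q`. -/
def conormalImage (Q : CourantOps 𝕜 𝕂 E X) (i : Z → X) (z : Z) : Submodule 𝕂 (Q.Fiber (i z)) :=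
  (conormal 𝕜 𝕂 E E' i z).map (Q.coanchor (i z))

/-- `π^†(N^∨_{Z|X})` at `z`, as a subspace of the fibre of `𝒯_Z ×_{i^*𝒯_X} i^*Q`. -/
def conormalSub (Q : CourantOps 𝕜 𝕂 E X) (i : Z → X) (z : Z) : Submodule 𝕂 (Q.fibProd E' i z) :=
  ((Q.conormalImage E' i z).map (LinearMap.inr 𝕂 (Tan 𝕜 𝕂 E' z) (Q.Fiber (i z)))).comap
    (Q.fibProd E' i z).subtype

/-- The fibre of `i^{++}Q = (𝒯_Z ×_{i^*𝒯_X} i^*Q) / π^†(N^∨_{Z|X})`. -/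
abbrev PullFiber (Q : CourantOps 𝕜 𝕂 E X) (i : Z → X) (z : Z) : Type _ :=
  Q.fibProd E' i z ⧸ Q.conormalSub E' i z

/-- The class in `i^{++}Q` of an element of `𝒯_Z ×_{i^*𝒯_X} i^*Q`. -/
abbrev pullMk (Q : CourantOps 𝕜 𝕂 E X) (i : Z → X) (z : Z) :
    Q.fibProd E' i z →ₗ[𝕂] Q.PullFiber E' i z :=
  (Q.conormalSub E' i z).mkQ

/-- The section `q` of `Q` near `i z` lifts the section `s` of `i^{++}Q` near `z`. -/
def Lifts (Q : CourantOps 𝕜 𝕂 E X) (i : Z → X) (s : ∀ z, Q.PullFiber E' i z) (z : Z)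
    (q : ∀ x, Q.Fiber x) : Prop :=
  Q.IsSec q (i z) ∧ ∀ᶠ w in 𝓝 z, ∃ u : Q.fibProd E' i w, u.1.2 = q (i w) ∧ s w = Q.pullMk E' i w u

/-- The pairing on `𝒯_Z ×_{i^*𝒯_X} i^*Q`. -/
def fibPairing (Q : CourantOps 𝕜 𝕂 E X) (i : Z → X) (z : Z) :
    Q.fibProd E' i z →ₗ[𝕂] Q.fibProd E' i z →ₗ[𝕂] 𝕂 :=
  (Q.pairing (i z)).compl₁₂ (LinearMap.snd 𝕂 _ _ ∘ₗ (Q.fibProd E' i z).subtype)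
    (LinearMap.snd 𝕂 _ _ ∘ₗ (Q.fibProd E' i z).subtype)

variable {n} in
theorem fibPairing_conormalSub {Q : CourantOps 𝕜 𝕂 E X} (hQ : Q.IsCourant n) (i : Z → X) (z : Z)
    (u v : Q.fibProd E' i z) (hv : v ∈ Q.conormalSub E' i z) : Q.fibPairing E' i z u v = 0 := by
  obtain ⟨w, ⟨α, hα, rfl⟩, hw⟩ := hv
  have hv2 : v.1.2 = Q.coanchor (i z) α := (congrArg Prod.snd hw).symm
  have hu : diff 𝕜 𝕂 E E' i z u.1.1 = Q.anchor (i z) u.1.2 := u.2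
  have hα' : codiff 𝕜 𝕂 E E' i z α = 0 := hα
  change Q.pairing (i z) u.1.2 v.1.2 = 0
  rw [hv2, hQ.pairing_coanchor, ← hu]
  change u.1.1 (codiff 𝕜 𝕂 E E' i z α) = 0
  rw [hα', map_zero]

variable {n} in
/-- The map `i^*Ω¹_X → i^{++}Q` induced by `π^†`. -/
def pullCoanchorAux {Q : CourantOps 𝕜 𝕂 E X} (hQ : Q.IsCourant n) (i : Z → X) (z : Z) :
    Cot 𝕜 𝕂 E (i z) →ₗ[𝕂] Q.PullFiber E' i z :=
  Q.pullMk E' i z ∘ₗ (LinearMap.inr 𝕂 (Tan 𝕜 𝕂 E' z) (Q.Fiber (i z)) ∘ₗ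
    Q.coanchor (i z)).codRestrict (Q.fibProd E' i z) (fun α => by
      change diff 𝕜 𝕂 E E' i z 0 = Q.anchor (i z) (Q.coanchor (i z) α)
      rw [hQ.anchor_coanchor, map_zero])

variable {n E'} in
/-- The inverse image `i^{++}Q` under an embedding `i : Z → X`. -/
def pull [FiniteDimensional 𝕜 E] [IsManifold 𝓘(𝕜, E) n X] [IsManifold 𝓘(𝕜, E') n Z]
    (hn : ∞ ≤ n) {i : Z → X} (hi : Manifold.IsSmoothEmbedding 𝓘(𝕜, E') 𝓘(𝕜, E) n i)
    (Q : CourantOps 𝕜 𝕂 E X) (hQ : Q.IsCourant n) : CourantOps 𝕜 𝕂 E' Z where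
  Fiber := Q.PullFiber E' i
  /- The sections are locally the classes of pairs of a section `ξ` of `𝒯_Z` and a section `σ` of
  `i^*Q` with the same image in `i^*𝒯_X`. -/
  IsSec s z := ∃ (ξ : ∀ w, Tan 𝕜 𝕂 E' w) (σ : ∀ w, Q.Fiber (i w)),
    IsVec 𝕜 E' n ξ z ∧ (Q.toModFamily.pullback 𝕜 n E' i).IsSec σ z ∧
      ∀ᶠ w in 𝓝 z, ∃ h : (ξ w, σ w) ∈ Q.fibProd E' i w, s w = Q.pullMk E' i w ⟨(ξ w, σ w), h⟩
  /- The bracket of `s` and `t` is the class of the restriction to `Z` of `{q, p}`, for any lifts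
  `q` and `p` of `s` and `t` to sections of `Q`. -/
  bracket s t z := Classical.epsilon fun v : Q.PullFiber E' i z =>
    ∃ q p, Q.Lifts E' i s z q ∧ Q.Lifts E' i t z p ∧
      ∃ u : Q.fibProd E' i z, u.1.2 = Q.bracket q p (i z) ∧ v = Q.pullMk E' i z u
  /- the anchor is `(ξ, v) ↦ ξ` -/
  anchor z := (Q.conormalSub E' i z).liftQ (LinearMap.fst 𝕂 _ _ ∘ₗ (Q.fibProd E' i z).subtype) (by
    rintro v ⟨w, -, hw⟩
    exact (congrArg Prod.fst hw).symm)
  /- the pairing is `⟨(ξ, v), (η, w)⟩ = ⟨v, w⟩` -/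
  pairing z := (Q.conormalSub E' i z).liftQ
    (((Q.conormalSub E' i z).liftQ (Q.fibPairing E' i z).flip (fun v hv =>
      LinearMap.ext fun u => fibPairing_conormalSub E' hQ i z u v hv)).flip) (fun v hv => by
      refine LinearMap.ext fun u => ?_
      obtain ⟨u, rfl⟩ := Submodule.mkQ_surjective _ u
      exact (hQ.pairing_symm _ _ _).trans (fibPairing_conormalSub E' hQ i z u v hv))
  /- the co-anchor is `(di)^∨(α) ↦ (0, π^†(α))` -/
  coanchor z := ((LinearMap.ker (codiff 𝕜 𝕂 E E' i z)).liftQ (pullCoanchorAux E' hQ i z) (by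
      intro α hα
      refine (Submodule.Quotient.mk_eq_zero _).2 ?_
      exact ⟨Q.coanchor (i z) α, ⟨α, hα, rfl⟩, rfl⟩)) ∘ₗ
    ((codiff 𝕜 𝕂 E E' i z).quotKerEquivOfSurjective
      (codiff_surjective 𝕜 n hn hi.isImmersion z)).symm.toLinearMap

/-- `i^{++}K = K / π^†(N^∨_{Z|X})`: the image in `i^{++}Q` of the elements `(ξ, v)` of
`𝒯_Z ×_{i^*𝒯_X} i^*Q` with `v ∈ K`. -/
def pullSub (Q : CourantOps 𝕜 𝕂 E X) (i : Z → X) (K : ∀ z, Submodule 𝕂 (Q.Fiber (i z))) (z : Z) :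
    Submodule 𝕂 (Q.PullFiber E' i z) :=
  ((K z).comap (LinearMap.snd 𝕂 _ _ ∘ₗ (Q.fibProd E' i z).subtype)).map (Q.pullMk E' i z)

end

end CourantOps

end CourantDirac

end

/-! Fibrewise this is coisotropic reduction. Inside `i^*Q` put `C = π^†(N^∨)` (`conormalImage`) and
`T = π⁻¹(𝒯_Z)` (`tangentSub`). Tangent vectors to `Z` are those annihilated by the conormal space,
and `⟨q, π^†α⟩ = α(πq)`, so `T` is the orthogonal of `C`; since `ππ^† = 0`, also `C ⊆ T`, and `C` is
isotropic. The fibre product projects isomorphically onto `T`, so `i^{++}Q` is `T / C` with the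
induced pairing. A maximal isotropic `K ⊆ T` contains `C`, because `K + C` is again isotropic;
conversely, an isotropic subspace containing `C` lies in the orthogonal of `C`, which is `T`. Hence
taking images in `T / C` and preimages in `T` are inverse to each other
(`conormalImage_le_of_maximal`, `tangentSub_inf_comap_pullSub`, `isAlmostDirac_of_pull`).

For sub-bundles, `T` is locally the kernel of finitely many linear forms and `C` is locally spanned
by finitely many sections. Constant rank makes both regular, and frames adapted to `C ⊆ K ⊆ T` carry
sub-bundles across the quotient (`isRegularAt_ker`, `exists_adapted_frame`, `isSubbundle_map`,
`isSubbundle_comap`).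

For the bracket, sections of `Q` whose restriction lies in `T` are closed under it, and among them
those with restriction in `C` form a two-sided ideal (`bracket_mem_tangentSub`,
`bracket_mem_conormalImage_right`, `bracket_mem_conormalImage_left`). So the bracket on `T / C` can
be computed with any lifts (`bracket_pull`), and lifts exist because functions extend locally from
`Z` to `X`. Closedness of `K` and of `K / C` then amount to the same condition, once it is stated
for germs (`isDirac_iff_local`). -/

noncomputable section

namespace CourantDirac

/-! ### The structure sheaf -/

section Functions

variable {𝕜 : Type*} [RCLike 𝕜] {𝕂 : Type*} [RCLike 𝕂] [NormedAlgebra 𝕜 𝕂]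
  {E : Type*} [NormedAddCommGroup E] [NormedSpace 𝕜 E] {n : WithTop ℕ∞}
  {X : Type*} [TopologicalSpace X] [ChartedSpace E X]
  {E' : Type*} [NormedAddCommGroup E'] [NormedSpace 𝕜 E']
  {Z : Type*} [TopologicalSpace Z] [ChartedSpace E' Z]
  {f g : X → 𝕂} {x : X}

theorem IsFun.contMDiffAt (hf : IsFun 𝕜 E n f x) : ContMDiffAt 𝓘(𝕜, E) 𝓘(𝕜, 𝕂) n f x :=
  hf.self_of_nhds

theorem IsFun.eventually (hf : IsFun 𝕜 E n f x) : ∀ᶠ y in 𝓝 x, IsFun 𝕜 E n f y :=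
  eventually_eventually_nhds.2 hf

theorem IsFun.congr (hf : IsFun 𝕜 E n f x) (h : ∀ᶠ y in 𝓝 x, g y = f y) : IsFun 𝕜 E n g x := by
  filter_upwards [hf, eventually_eventually_nhds.2 h] with y hy hy'
  exact hy.congr_of_eventuallyEq hy'

theorem isFun_const (c : 𝕂) (x : X) : IsFun 𝕜 E n (fun _ => c) x :=
  Eventually.of_forall fun _ => contMDiffAt_const

theorem IsFun.add (hf : IsFun 𝕜 E n f x) (hg : IsFun 𝕜 E n g x) :
    IsFun 𝕜 E n (fun y => f y + g y) x := by
  filter_upwards [hf, hg] with y hy hy'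
  exact ContMDiffAt.comp (g := fun p : 𝕂 × 𝕂 => p.1 + p.2) (I' := 𝓘(𝕜, 𝕂 × 𝕂)) y
    (contDiff_add (𝕜 := 𝕜)).contMDiff.contMDiffAt (hy.prodMk_space hy')

theorem IsFun.mul (hf : IsFun 𝕜 E n f x) (hg : IsFun 𝕜 E n g x) :
    IsFun 𝕜 E n (fun y => f y * g y) x := by
  filter_upwards [hf, hg] with y hy hy'
  exact ContMDiffAt.comp (g := fun p : 𝕂 × 𝕂 => p.1 * p.2) (I' := 𝓘(𝕜, 𝕂 × 𝕂)) y
    (contDiff_mul (𝕜 := 𝕜)).contMDiff.contMDiffAt (hy.prodMk_space hy')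

theorem IsFun.neg (hf : IsFun 𝕜 E n f x) : IsFun 𝕜 E n (fun y => -f y) x := by
  simpa using (isFun_const (-1 : 𝕂) x).mul hf

theorem IsFun.sub (hf : IsFun 𝕜 E n f x) (hg : IsFun 𝕜 E n g x) :
    IsFun 𝕜 E n (fun y => f y - g y) x := by
  simpa [sub_eq_add_neg] using hf.add hg.neg

theorem IsFun.sum {ι : Type*} {s : Finset ι} {F : ι → X → 𝕂}
    (hF : ∀ j ∈ s, IsFun 𝕜 E n (F j) x) : IsFun 𝕜 E n (fun y => ∑ j ∈ s, F j y) x := by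
  classical
  induction s using Finset.induction_on with
  | empty => simpa using isFun_const (0 : 𝕂) x
  | insert a s ha ih =>
    simp only [Finset.sum_insert ha]
    exact (hF a (by simp)).add (ih fun j hj => hF j (by simp [hj]))

theorem IsFun.prod {ι : Type*} {s : Finset ι} {F : ι → X → 𝕂}
    (hF : ∀ j ∈ s, IsFun 𝕜 E n (F j) x) : IsFun 𝕜 E n (fun y => ∏ j ∈ s, F j y) x := by
  classical
  induction s using Finset.induction_on with
  | empty => simpa using isFun_const (1 : 𝕂) x
  | insert a s ha ih =>
    simp only [Finset.prod_insert ha]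
    exact (hF a (by simp)).mul (ih fun j hj => hF j (by simp [hj]))

theorem IsFun.continuousAt (hf : IsFun 𝕜 E n f x) : ContinuousAt f x :=
  hf.contMDiffAt.continuousAt

theorem IsFun.eventually_ne (hf : IsFun 𝕜 E n f x) (h0 : f x ≠ 0) : ∀ᶠ y in 𝓝 x, f y ≠ 0 :=
  hf.continuousAt.eventually_ne h0

theorem IsFun.inv (hf : IsFun 𝕜 E n f x) (h0 : f x ≠ 0) : IsFun 𝕜 E n (fun y => (f y)⁻¹) x := by
  filter_upwards [hf, hf.eventually_ne h0] with y hy hy'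
  exact ContMDiffAt.comp (g := fun a : 𝕂 => a⁻¹) (I' := 𝓘(𝕜, 𝕂)) y
    (contDiffAt_inv 𝕜 hy').contMDiffAt hy

theorem IsFun.comp {i : Z → X} (hi : ContMDiff 𝓘(𝕜, E') 𝓘(𝕜, E) n i) {z : Z}
    (hf : IsFun 𝕜 E n f (i z)) : IsFun 𝕜 E' n (fun w => f (i w)) z := by
  filter_upwards [hi.continuous.continuousAt.eventually hf] with w hw
  exact hw.comp w hi.contMDiffAt

theorem isFun_det {r : ℕ} {M : X → Matrix (Fin r) (Fin r) 𝕂}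
    (hM : ∀ j k, IsFun 𝕜 E n (fun y => M y j k) x) : IsFun 𝕜 E n (fun y => (M y).det) x := by
  simp only [Matrix.det_apply']
  exact IsFun.sum fun σ _ => (isFun_const _ x).mul (IsFun.prod fun j _ => hM _ _)

/-- Cramer's rule: an entry of the adjugate is the determinant of the matrix with one row replaced
by a constant basis vector. -/
theorem isFun_matrix_inv {r : ℕ} {M : X → Matrix (Fin r) (Fin r) 𝕂}
    (hM : ∀ j k, IsFun 𝕜 E n (fun y => M y j k) x) (h0 : (M x).det ≠ 0) (j k : Fin r) :
    IsFun 𝕜 E n (fun y => (M y)⁻¹ j k) x := by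
  simp only [Matrix.inv_def, Matrix.smul_apply, Ring.inverse_eq_inv', smul_eq_mul]
  refine ((isFun_det hM).inv h0).mul ?_
  simp only [Matrix.adjugate_apply]
  refine isFun_det fun a b => ?_
  by_cases ha : a = k
  · subst ha; simpa using isFun_const _ x
  · simpa [Matrix.updateRow_apply, ha] using hM a b

theorem dif_congr (h : ∀ᶠ y in 𝓝 x, f y = g y) : dif 𝕜 E f x = dif 𝕜 E g x := by
  have h1 : mfderiv 𝓘(𝕜, E) 𝓘(𝕜, 𝕂) f x = mfderiv 𝓘(𝕜, E) 𝓘(𝕜, 𝕂) g x :=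
    EventuallyEq.mfderiv_eq h
  exact h1

theorem dif_zero : dif 𝕜 E (fun _ : X => (0 : 𝕂)) x = 0 :=
  mvfderiv_const (0 : 𝕂)

theorem codiff_dif (hn : n ≠ 0) {i : Z → X} (hi : ContMDiff 𝓘(𝕜, E') 𝓘(𝕜, E) n i) {z : Z}
    (hf : IsFun 𝕜 E n f (i z)) :
    codiff 𝕜 𝕂 E E' i z (dif 𝕜 E f (i z)) = dif 𝕜 E' (fun w => f (i w)) z :=
  (mfderiv_comp z (hf.contMDiffAt.mdifferentiableAt hn) (hi.mdifferentiable hn z)).symm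

/-- By the chain rule `df` pulls back to `d(f ∘ i)`, which only sees the values of `f` on `Z`.
Combined with `mem_tangentSub_iff`, this makes tangent vector fields preserve the functions
vanishing on `Z`. -/
theorem dif_mem_conormal (hn : n ≠ 0) {i : Z → X} (hi : ContMDiff 𝓘(𝕜, E') 𝓘(𝕜, E) n i) {z : Z}
    (hf : IsFun 𝕜 E n f (i z)) (h0 : ∀ᶠ w in 𝓝 z, f (i w) = 0) :
    dif 𝕜 E f (i z) ∈ conormal 𝕜 𝕂 E E' i z := by
  change codiff 𝕜 𝕂 E E' i z (dif 𝕜 E f (i z)) = 0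
  rw [codiff_dif hn hi hf, dif_congr h0, dif_zero]

end Functions

/-! ### Immersions -/

section Immersion

variable {𝕜 : Type*} [RCLike 𝕜] {𝕂 : Type*} [RCLike 𝕂] [NormedAlgebra 𝕜 𝕂]
  {E : Type*} [NormedAddCommGroup E] [NormedSpace 𝕜 E] {n : WithTop ℕ∞}
  {X : Type*} [TopologicalSpace X] [ChartedSpace E X]
  {E' : Type*} [NormedAddCommGroup E'] [NormedSpace 𝕜 E']
  {Z : Type*} [TopologicalSpace Z] [ChartedSpace E' Z] {i : Z → X}

theorem codChart_comp_eq {z : Z} (hz : Manifold.IsImmersionAt 𝓘(𝕜, E') 𝓘(𝕜, E) n i z) {w : Z}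
    (hw : w ∈ hz.domChart.source) : hz.codChart (i w) = hz.equiv (hz.domChart w, 0) := by
  have h := hz.writtenInCharts
    (show hz.domChart w ∈ (hz.domChart.extend 𝓘(𝕜, E')).target by
      simpa [OpenPartialHomeomorph.extend] using hz.domChart.map_source hw)
  simp only [Function.comp_apply, OpenPartialHomeomorph.extend, mfld_simps] at h
  simpa [hw] using h

/-- In charts adapted to the immersion, `Z` is a linear slice; composing `f` with the projection
onto the slice extends it, constant in the transverse directions. -/
theorem exists_isFun_extension (hi : Manifold.IsImmersion 𝓘(𝕜, E') 𝓘(𝕜, E) n i) {z : Z}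
    {f : Z → 𝕂} (hf : IsFun 𝕜 E' n f z) :
    ∃ F : X → 𝕂, IsFun 𝕜 E n F (i z) ∧ ∀ᶠ w in 𝓝 z, F (i w) = f w := by
  have hz := hi.isImmersionAt z
  let p : X → E' := fun y => (hz.equiv.symm (hz.codChart y)).1
  have hpz {w : Z} (hw : w ∈ hz.domChart.source) : p (i w) = hz.domChart w := by
    simp [p, codChart_comp_eq hz hw]
  have hps : ∀ y ∈ hz.codChart.source, ContMDiffAt 𝓘(𝕜, E) 𝓘(𝕜, E') n p y := fun y hy =>
    ContMDiffAt.comp (I' := 𝓘(𝕜, E)) (g := fun e : E => (hz.equiv.symm e).1) y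
      ((ContinuousLinearMap.fst 𝕜 E' hz.complement).comp
        (hz.equiv.symm : E →L[𝕜] E' × hz.complement)).contDiff.contMDiff.contMDiffAt
      (contMDiffAt_of_mem_maximalAtlas hz.codChart_mem_maximalAtlas hy)
  have hpc : ContinuousAt p (i z) := (hps _ hz.mem_codChart_source).continuousAt
  have hpiz : p (i z) = hz.domChart z := hpz hz.mem_domChart_source
  refine ⟨fun y => f (hz.domChart.symm (p y)), ?_, ?_⟩
  · have h1 : ∀ᶠ e in 𝓝 (hz.domChart z), ContMDiffAt 𝓘(𝕜, E') 𝓘(𝕜, 𝕂) n f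
        (hz.domChart.symm e) := by
      have hc := hz.domChart.continuousAt_symm (hz.domChart.map_source hz.mem_domChart_source)
      rw [ContinuousAt, hz.domChart.left_inv hz.mem_domChart_source] at hc
      exact hc.eventually hf
    rw [← hpiz] at h1
    have h2 : ∀ᶠ e in 𝓝 (p (i z)), e ∈ hz.domChart.target := by
      rw [hpiz]
      exact hz.domChart.open_target.mem_nhds (hz.domChart.map_source hz.mem_domChart_source)
    filter_upwards [hpc.eventually h1, hpc.eventually h2,
      hz.codChart.open_source.mem_nhds hz.mem_codChart_source] with y h1 h2 h3
    exact ContMDiffAt.comp (g := f) (I' := 𝓘(𝕜, E')) y h1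
      (ContMDiffAt.comp (g := hz.domChart.symm) (I' := 𝓘(𝕜, E')) y
        (contMDiffAt_symm_of_mem_maximalAtlas hz.domChart_mem_maximalAtlas h2) (hps y h3))
  · filter_upwards [hz.domChart.open_source.mem_nhds hz.mem_domChart_source] with w hw
    rw [hpz hw, hz.domChart.left_inv hw]

/-- Evaluation of covectors on a tangent vector. -/
def cotEval (x : X) (v : E) : Cot 𝕜 𝕂 E x →ₗ[𝕂] 𝕂 where
  toFun α := (show E →L[𝕜] 𝕂 from α) v
  map_add' _ _ := rfl
  map_smul' _ _ := rfl

/-- Near each point the conormal bundle is spanned by the differentials of finitely many functions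
vanishing on the submanifold. -/
theorem exists_conormal_generators [FiniteDimensional 𝕜 E] (hn : n ≠ 0)
    (hi : Manifold.IsImmersion 𝓘(𝕜, E') 𝓘(𝕜, E) n i) (z : Z) :
    ∃ (m : ℕ) (f : Fin m → X → 𝕂), (∀ j, IsFun 𝕜 E n (f j) (i z)) ∧
      (∀ j, ∀ᶠ w in 𝓝 z, f j (i w) = 0) ∧
      ∀ᶠ w in 𝓝 z, conormal 𝕜 𝕂 E E' i w =
        Submodule.span 𝕂 (Set.range fun j => dif 𝕜 E (f j) (i w)) := by
  have hz := hi.isImmersionAt z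
  have : FiniteDimensional 𝕜 (E' × hz.complement) :=
    LinearEquiv.finiteDimensional hz.equiv.symm.toLinearEquiv
  have : FiniteDimensional 𝕜 hz.complement :=
    FiniteDimensional.of_surjective (LinearMap.snd 𝕜 E' hz.complement) LinearMap.snd_surjective
  -- The generators are the transverse coordinates of the adapted chart, which vanish on the slice
  -- `hz.complement = 0`.
  let b := finBasis 𝕜 hz.complement
  let l : Fin (finrank 𝕜 hz.complement) → E →L[𝕜] 𝕂 := fun j =>
    (Algebra.linearMap 𝕜 𝕂 ∘ₗ b.coord j ∘ₗ LinearMap.snd 𝕜 E' hz.complement ∘ₗ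
      hz.equiv.symm.toLinearEquiv.toLinearMap).toContinuousLinearMap
  have hl (j) (e : E) : l j e = algebraMap 𝕜 𝕂 (b.coord j (hz.equiv.symm e).2) := rfl
  have hψ := hz.codChart_mem_maximalAtlas
  let f : Fin (finrank 𝕜 hz.complement) → X → 𝕂 := fun j y => l j (hz.codChart y)
  have hfs : ∀ j, ∀ y ∈ hz.codChart.source, ContMDiffAt 𝓘(𝕜, E) 𝓘(𝕜, 𝕂) n (f j) y :=
    fun j y hy => ContMDiffAt.comp (I' := 𝓘(𝕜, E)) (g := l j) y
      (l j).contDiff.contMDiff.contMDiffAt (contMDiffAt_of_mem_maximalAtlas hψ hy)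
  have hfF : ∀ j, ∀ y ∈ hz.codChart.source, IsFun 𝕜 E n (f j) y := fun j y hy =>
    eventually_of_mem (hz.codChart.open_source.mem_nhds hy) (hfs j)
  have hf0 : ∀ j, ∀ w ∈ hz.domChart.source, f j (i w) = 0 := fun j w hw => by
    simp [f, hl, codChart_comp_eq hz hw]
  have hev : ∀ w ∈ hz.domChart.source, ∀ᶠ v in 𝓝 w, v ∈ hz.domChart.source := fun w hw =>
    hz.domChart.open_source.mem_nhds hw
  refine ⟨_, f, fun j => hfF j _ hz.mem_codChart_source, fun j => ?_, ?_⟩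
  · filter_upwards [hev z hz.mem_domChart_source] with w hw using hf0 j w hw
  filter_upwards [hev z hz.mem_domChart_source] with w hw
  have hiw : i w ∈ hz.codChart.source := hz.source_subset_preimage_source hw
  refine le_antisymm ?_ (Submodule.span_le.2 ?_)
  swap
  · rintro _ ⟨j, rfl⟩
    refine dif_mem_conormal hn hi.contMDiff (hfF j _ hiw) ?_
    filter_upwards [hev w hw] with v hv using hf0 j v hv
  intro α hα
  have hψd : hz.codChart.MDifferentiable 𝓘(𝕜, E) 𝓘(𝕜, E) :=
    ⟨(contMDiffOn_of_mem_maximalAtlas hψ).mdifferentiableOn hn,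
      (contMDiffOn_symm_of_mem_maximalAtlas hψ).mdifferentiableOn hn⟩
  have hφ := hz.domChart_mem_maximalAtlas
  have hφd : hz.domChart.MDifferentiable 𝓘(𝕜, E') 𝓘(𝕜, E') :=
    ⟨(contMDiffOn_of_mem_maximalAtlas hφ).mdifferentiableOn hn,
      (contMDiffOn_symm_of_mem_maximalAtlas hφ).mdifferentiableOn hn⟩
  let Ψ : E →L[𝕜] E := mfderiv 𝓘(𝕜, E) 𝓘(𝕜, E) hz.codChart (i w)
  let Φ : E' →L[𝕜] E' := mfderiv 𝓘(𝕜, E') 𝓘(𝕜, E') hz.domChart w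
  let D : E' →L[𝕜] E := mfderiv 𝓘(𝕜, E') 𝓘(𝕜, E) i w
  let a : E →L[𝕜] 𝕂 := α
  have hΨ : Function.Injective Ψ := hψd.mfderiv_injective hiw
  have hΨs : Function.Surjective Ψ := hψd.mfderiv_surjective hiw
  have hΦ : Function.Surjective Φ := hφd.mfderiv_surjective hw
  have hα0 : ∀ v, a (D v) = 0 := fun v => congrArg (fun β : E' →L[𝕜] 𝕂 => β v) hα
  have hdf : ∀ j v, cotEval (i w) v (dif 𝕜 E (f j) (i w)) = l j (Ψ v) := by
    intro j v
    have h := mfderiv_comp (I' := 𝓘(𝕜, E)) (i w) (g := l j) (f := hz.codChart)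
      (I'' := 𝓘(𝕜, 𝕂)) (l j).differentiableAt.mdifferentiableAt (hψd.mdifferentiableAt hiw)
    rw [mfderiv_eq_fderiv, (l j).fderiv] at h
    exact congrArg (fun β : E →L[𝕜] 𝕂 => β v) h
  have hcomp : ∀ v, Ψ (D v) = hz.equiv (Φ v, 0) := by
    intro v
    let L : E' →L[𝕜] E := (hz.equiv : (E' × hz.complement) →L[𝕜] E).comp
      (ContinuousLinearMap.inl 𝕜 E' hz.complement)
    have h1 := mfderiv_comp (I' := 𝓘(𝕜, E)) w (hψd.mdifferentiableAt hiw)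
      (hi.contMDiff.mdifferentiable hn w)
    have h2 := mfderiv_comp (I' := 𝓘(𝕜, E')) w (g := L) (f := hz.domChart)
      (I'' := 𝓘(𝕜, E)) L.differentiableAt.mdifferentiableAt (hφd.mdifferentiableAt hw)
    rw [mfderiv_eq_fderiv, L.fderiv] at h2
    have h3 : (hz.codChart ∘ i) =ᶠ[𝓝 w] (L ∘ hz.domChart) := by
      filter_upwards [hev w hw] with v hv
      exact codChart_comp_eq hz hv
    have h4 := h3.mfderiv_eq (I := 𝓘(𝕜, E')) (I' := 𝓘(𝕜, E))
    exact congrArg (fun β : E' →L[𝕜] E => β v) (h1.symm.trans (h4.trans h2))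
  let R := (LinearEquiv.ofBijective (Ψ : E →ₗ[𝕜] E) ⟨hΨ, hΨs⟩)
  -- Transported by the chart, a vector splits into a part along the slice, which is in the image of
  -- `di` and killed by the conormal covector `a`, and a transverse part, whose coordinates are the
  -- `l j e`.
  have key : ∀ e : E, a (R.symm e) = ∑ j, a (R.symm (hz.equiv (0, b j))) * l j e := by
    intro e
    obtain ⟨u, rfl⟩ := hz.equiv.surjective e
    obtain ⟨v, hv⟩ := hΦ u.1
    have h1 : R.symm (hz.equiv (u.1, 0)) = D v := by
      rw [LinearEquiv.symm_apply_eq, ← hv, ← hcomp]; rfl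
    have h2 : u = (u.1, 0) + ∑ j, b.repr u.2 j • ((0 : E'), b j) := by
      refine Prod.ext ?_ ?_
      · simp [Prod.fst_sum]
      · simp [Prod.snd_sum, b.sum_repr]
    conv_lhs => rw [h2]
    rw [map_add, map_add, h1, map_add, hα0, zero_add]
    simp only [map_sum, map_smul]
    refine Finset.sum_congr rfl fun j _ => ?_
    rw [hl, Algebra.smul_def, mul_comm]
    simp
  have : α = ∑ j, a (R.symm (hz.equiv (0, b j))) • dif 𝕜 E (f j) (i w) := by
    refine ContinuousLinearMap.ext fun (v : E) => ?_
    have h := key (Ψ v)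
    rw [show R.symm (Ψ v) = v from R.symm_apply_apply v] at h
    refine h.trans ?_
    change _ = cotEval (E := E) (i w) v _
    rw [map_sum]
    exact Finset.sum_congr rfl fun j _ => by rw [map_smul, hdf, smul_eq_mul]
  rw [this]
  exact Submodule.sum_mem _ fun j _ => Submodule.smul_mem _ _ (Submodule.subset_span ⟨j, rfl⟩)

end Immersion

/-! ### Linear algebra -/

section LinearAlgebra

variable {K V : Type*} [Field K] [AddCommGroup V] [Module K V]

theorem exists_sum_basis [FiniteDimensional K V] {ι : Type*} {v : ι → V}
    (hv : LinearIndependent K v) : ∃ (m : ℕ) (u : Fin m → V),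
      LinearIndependent K (Sum.elim v u) ∧ Submodule.span K (Set.range (Sum.elim v u)) = ⊤ := by
  obtain ⟨W, hW⟩ := Submodule.exists_isCompl (Submodule.span K (Set.range v))
  let b := finBasis K W
  have hb : Submodule.span K (Set.range fun j => (b j : V)) = W := by
    have h : (Set.range fun j => (b j : V)) = W.subtype '' Set.range b := by
      rw [← Set.range_comp]; rfl
    rw [h, Submodule.span_image, b.span_eq, Submodule.map_top, Submodule.range_subtype]
  refine ⟨_, fun j => (b j : V), linearIndependent_sum.2 ⟨hv, ?_, ?_⟩, ?_⟩
  · exact b.linearIndependent.map' W.subtype (Submodule.ker_subtype W)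
  · change Disjoint (Submodule.span K (Set.range v)) (Submodule.span K (Set.range fun j => (b j : V)))
    rw [hb]
    exact hW.disjoint
  · rw [Set.Sum.elim_range, Submodule.span_union, hb]
    exact hW.sup_eq_top

/-- Used to see that the coefficients of a section in a frame vanish outside the part of the frame
spanning a sub-bundle that contains the section. -/
theorem coeff_eq_zero_of_mem_span {ι : Type*} [Fintype ι] {v : ι → V}
    (hv : LinearIndependent K v) {c : ι → K} {J : Set ι}
    (h : ∑ j, c j • v j ∈ Submodule.span K (v '' J)) {j : ι} (hj : j ∉ J) : c j = 0 := by
  obtain ⟨l, hl, hlc⟩ := (Finsupp.mem_span_image_iff_linearCombination K).1 h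
  have h2 : ∑ k, (c k - l k) • v k = 0 := by
    rw [Finsupp.linearCombination_apply, Finsupp.sum_fintype _ _ (by simp)] at hlc
    simp only [sub_smul, Finset.sum_sub_distrib, hlc, sub_self]
  have h3 := Fintype.linearIndependent_iff.1 hv _ h2 j
  have h4 : l j = 0 := by
    by_contra h5
    exact hj (hl (Finsupp.mem_support_iff.2 h5))
  simpa [h4] using h3

/-- A section of `f` over its range, extended arbitrarily. Then `1 - g f` maps into the kernel of
`f`, which is how `isRegularAt_ker` uses it. -/
theorem exists_generalized_inverse {W : Type*} [AddCommGroup W] [Module K W] (f : V →ₗ[K] W) :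
    ∃ g : W →ₗ[K] V, ∀ v, f (g (f v)) = f v := by
  obtain ⟨g, hg⟩ := f.rangeRestrict.exists_rightInverse_of_surjective f.range_rangeRestrict
  obtain ⟨g', hg'⟩ := LinearMap.exists_extend g
  refine ⟨g', fun v => ?_⟩
  have h1 : g' (f v) = g (f.rangeRestrict v) := LinearMap.congr_fun hg' (f.rangeRestrict v)
  rw [h1]
  exact congrArg Subtype.val (LinearMap.congr_fun hg (f.rangeRestrict v))

end LinearAlgebra

/-! ### Frames -/

namespace ModFamily

variable {𝕜 : Type*} [RCLike 𝕜] {𝕂 : Type*} [RCLike 𝕂] [NormedAlgebra 𝕜 𝕂]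
  {E : Type*} [NormedAddCommGroup E] [NormedSpace 𝕜 E] {n : WithTop ℕ∞}
  {X : Type*} [TopologicalSpace X] [ChartedSpace E X]
  {S : ModFamily 𝕂 X} {U V : Set X} {x : X}

section Frame

variable {r : ℕ} {e : Fin r → ∀ x, S.Fiber x}

theorem IsFrame.mono (he : S.IsFrame 𝕜 E n U e) (h : V ⊆ U) : S.IsFrame 𝕜 E n V e :=
  ⟨fun x hx => he.1 x (h hx), fun x hx => he.2 x (h hx)⟩

theorem IsFrame.isSec_sum (he : S.IsFrame 𝕜 E n U e) (hx : x ∈ U) {c : Fin r → X → 𝕂}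
    (hc : ∀ j, IsFun 𝕜 E n (c j) x) : S.IsSec (fun y => ∑ j, c j y • e j y) x :=
  (he.2 x hx _).2 ⟨c, hc, Eventually.of_forall fun _ => rfl⟩

theorem IsFrame.isSec (he : S.IsFrame 𝕜 E n U e) (hx : x ∈ U) (j : Fin r) : S.IsSec (e j) x := by
  refine (he.2 x hx _).2 ⟨fun k _ => if k = j then 1 else 0, fun k => isFun_const _ x,
    Eventually.of_forall fun y => ?_⟩
  simp

/-- The basis of a fibre given by a frame. -/
def IsFrame.basis (he : S.IsFrame 𝕜 E n U e) (hx : x ∈ U) : Basis (Fin r) 𝕂 (S.Fiber x) :=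
  Basis.mk (he.1 x hx).1 (he.1 x hx).2.ge

theorem IsFrame.basis_apply (he : S.IsFrame 𝕜 E n U e) (hx : x ∈ U) (j : Fin r) :
    he.basis hx j = e j x := Basis.mk_apply _ _ _

theorem IsFrame.finiteDimensional (he : S.IsFrame 𝕜 E n U e) (hx : x ∈ U) :
    FiniteDimensional 𝕂 (S.Fiber x) := (he.basis hx).finiteDimensional_of_finite

theorem IsFrame.finrank_eq (he : S.IsFrame 𝕜 E n U e) (hx : x ∈ U) :
    finrank 𝕂 (S.Fiber x) = r := by
  rw [finrank_eq_card_basis (he.basis hx), Fintype.card_fin]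

/-- Sections which are linearly independent at a point, as many as the rank, form a frame near
this point. -/
theorem IsFrame.exists_isFrame (hU : IsOpen U) (he : S.IsFrame 𝕜 E n U e) (hx : x ∈ U)
    {σ : Fin r → ∀ x, S.Fiber x} (hσ : ∀ j, S.IsSec (σ j) x)
    (hli : LinearIndependent 𝕂 fun j => σ j x) :
    ∃ V, IsOpen V ∧ x ∈ V ∧ V ⊆ U ∧ S.IsFrame 𝕜 E n V σ := by
  have h := fun j => (he.2 x hx (σ j)).1 (hσ j)
  choose a ha hσa using h
  -- The matrix of the sections `σ` in the frame `e`. They form a frame exactly where its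
  -- determinant is non-zero, an open condition; multiplying coefficients by `M` or its inverse
  -- changes frames.
  let M : X → Matrix (Fin r) (Fin r) 𝕂 := fun y => Matrix.of fun k j => a k j y
  have hM : ∀ y, y ∈ U → (∀ k, σ k y = ∑ j, a k j y • e j y) →
      (LinearIndependent 𝕂 (fun j => σ j y) ↔ (M y).det ≠ 0) := by
    intro y hy hay
    have h1 : (fun k => σ k y) = Fintype.linearCombination 𝕂 (fun j => e j y) ∘ (M y).row := by
      funext k
      simp [hay k, Fintype.linearCombination_apply, M]
    rw [← isUnit_iff_ne_zero, ← Matrix.isUnit_iff_isUnit_det,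
      ← Matrix.linearIndependent_rows_iff_isUnit, h1]
    refine LinearMap.linearIndependent_iff _ ?_
    exact LinearMap.ker_eq_bot.2
      (linearIndependent_iff_injective_fintypeLinearCombination.1 (he.1 y hy).1)
  have hx0 : (M x).det ≠ 0 := (hM x hx fun k => (hσa k).self_of_nhds).1 hli
  have hdet : ∀ᶠ y in 𝓝 x, (M y).det ≠ 0 := (isFun_det fun k j => ha k j).eventually_ne hx0
  have hev : ∀ᶠ y in 𝓝 x, y ∈ U ∧ (∀ k j, IsFun 𝕜 E n (a k j) y) ∧
      (∀ k, ∀ᶠ y' in 𝓝 y, σ k y' = ∑ j, a k j y' • e j y') ∧ (M y).det ≠ 0 := by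
    filter_upwards [hU.mem_nhds hx, eventually_all.2 fun k => eventually_all.2 fun j =>
      (ha k j).eventually, eventually_all.2 fun k => eventually_eventually_nhds.2 (hσa k), hdet]
      with y h1 h2 h3 h4 using ⟨h1, h2, h3, h4⟩
  obtain ⟨V, hV, hVo, hxV⟩ := eventually_nhds_iff.1 hev
  refine ⟨V, hVo, hxV, fun y hy => (hV y hy).1, fun y hy => ?_, fun y hy s => ?_⟩
  · obtain ⟨h1, -, h3, h4⟩ := hV y hy
    have hind := (hM y h1 fun k => (h3 k).self_of_nhds).2 h4
    have := he.finiteDimensional h1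
    exact ⟨hind, hind.span_eq_top_of_card_eq_finrank' (by rw [he.finrank_eq h1, Fintype.card_fin])⟩
  · obtain ⟨h1, h2, h3, h4⟩ := hV y hy
    rw [he.2 y h1 s]
    constructor
    · rintro ⟨c, hc, hs⟩
      refine ⟨fun k y' => ∑ j, c j y' * (M y')⁻¹ j k, fun k => IsFun.sum fun j _ => (hc j).mul
        (isFun_matrix_inv (fun k j => h2 k j) h4 j k), ?_⟩
      filter_upwards [hs, eventually_all.2 h3,
        (isFun_det fun k j => h2 k j).eventually_ne h4] with y' h5 h6 h7
      have h8 : ∀ j, e j y' = ∑ k, (M y')⁻¹ j k • σ k y' := by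
        intro j
        have h9 : ∀ l, ∑ k, (M y')⁻¹ j k * a k l y' = (1 : Matrix (Fin r) (Fin r) 𝕂) j l := by
          intro l
          rw [← Matrix.nonsing_inv_mul (M y') (isUnit_iff_ne_zero.2 h7)]
          rfl
        simp only [h6, Finset.smul_sum, smul_smul]
        rw [Finset.sum_comm]
        simp only [← Finset.sum_smul, h9, Matrix.one_apply, ite_smul, one_smul, zero_smul,
          Finset.sum_ite_eq, Finset.mem_univ, if_true]
      rw [h5]
      conv_lhs => simp only [h8, Finset.smul_sum, smul_smul]
      rw [Finset.sum_comm]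
      simp only [Finset.sum_smul]
    · rintro ⟨c, hc, hs⟩
      refine ⟨fun j y' => ∑ k, c k y' * a k j y', fun j => IsFun.sum fun k _ => (hc k).mul (h2 k j),
        ?_⟩
      filter_upwards [hs, eventually_all.2 h3] with y' h5 h6
      rw [h5]
      simp only [h6, Finset.smul_sum, smul_smul, Finset.sum_smul]
      rw [Finset.sum_comm]

end Frame

/-! ### Sections of locally free sheaves -/

section LocallyFree

variable (hS : S.IsLocallyFree 𝕜 E n) {s t : ∀ x, S.Fiber x}
include hS

theorem IsLocallyFree.finiteDimensional (x : X) : FiniteDimensional 𝕂 (S.Fiber x) := by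
  obtain ⟨U, -, hx, r, e, he⟩ := hS x
  exact he.finiteDimensional hx

theorem IsLocallyFree.isSec_eventually (hs : S.IsSec s x) : ∀ᶠ y in 𝓝 x, S.IsSec s y := by
  obtain ⟨U, hU, hx, r, e, he⟩ := hS x
  obtain ⟨c, hc, hsc⟩ := (he.2 x hx s).1 hs
  filter_upwards [hU.mem_nhds hx, eventually_all.2 fun j => (hc j).eventually,
    eventually_eventually_nhds.2 hsc] with y h1 h2 h3
  exact (he.2 y h1 s).2 ⟨c, h2, h3⟩

theorem IsLocallyFree.isSec_add (hs : S.IsSec s x) (ht : S.IsSec t x) :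
    S.IsSec (fun y => s y + t y) x := by
  obtain ⟨U, -, hx, r, e, he⟩ := hS x
  obtain ⟨c, hc, hsc⟩ := (he.2 x hx s).1 hs
  obtain ⟨d, hd, htd⟩ := (he.2 x hx t).1 ht
  refine (he.2 x hx _).2 ⟨fun j y => c j y + d j y, fun j => (hc j).add (hd j), ?_⟩
  filter_upwards [hsc, htd] with y h1 h2
  simp only [h1, h2, add_smul, Finset.sum_add_distrib]

theorem IsLocallyFree.isSec_smul {f : X → 𝕂} (hf : IsFun 𝕜 E n f x) (hs : S.IsSec s x) :
    S.IsSec (fun y => f y • s y) x := by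
  obtain ⟨U, -, hx, r, e, he⟩ := hS x
  obtain ⟨c, hc, hsc⟩ := (he.2 x hx s).1 hs
  refine (he.2 x hx _).2 ⟨fun j y => f y * c j y, fun j => hf.mul (hc j), ?_⟩
  filter_upwards [hsc] with y h1
  simp only [h1, Finset.smul_sum, mul_smul]

theorem IsLocallyFree.isSec_zero (x : X) : S.IsSec (fun _ => 0) x := by
  obtain ⟨U, -, hx, r, e, he⟩ := hS x
  exact (he.2 x hx _).2 ⟨fun _ _ => 0, fun _ => isFun_const 0 x, Eventually.of_forall (by simp)⟩

theorem IsLocallyFree.isSec_sub (hs : S.IsSec s x) (ht : S.IsSec t x) :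
    S.IsSec (fun y => s y - t y) x := by
  simpa [sub_eq_add_neg] using hS.isSec_add hs (hS.isSec_smul (isFun_const (-1) x) ht)

theorem IsLocallyFree.isSec_sum {ι : Type*} {J : Finset ι} {c : ι → X → 𝕂}
    {σ : ι → ∀ x, S.Fiber x} (hc : ∀ j ∈ J, IsFun 𝕜 E n (c j) x) (hσ : ∀ j ∈ J, S.IsSec (σ j) x) :
    S.IsSec (fun y => ∑ j ∈ J, c j y • σ j y) x := by
  classical
  induction J using Finset.induction_on with
  | empty => simpa using hS.isSec_zero x
  | insert a J ha ih =>
    simp only [Finset.sum_insert ha]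
    exact hS.isSec_add (hS.isSec_smul (hc a (by simp)) (hσ a (by simp)))
      (ih (fun j hj => hc j (by simp [hj])) fun j hj => hσ j (by simp [hj]))

theorem IsLocallyFree.exists_isSec (x : X) (v : S.Fiber x) : ∃ s, S.IsSec s x ∧ s x = v := by
  obtain ⟨U, -, hx, r, e, he⟩ := hS x
  refine ⟨fun y => ∑ j, (he.basis hx).repr v j • e j y,
    he.isSec_sum hx fun j => isFun_const _ x, ?_⟩
  conv_rhs => rw [← (he.basis hx).sum_repr v]
  simp only [he.basis_apply]

/-- Sections which are linearly independent at a point are a part of a frame near this point. -/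
theorem IsLocallyFree.exists_isFrame_extending {ι : Type*} [Finite ι] {τ : ι → ∀ x, S.Fiber x}
    (hτ : ∀ j, S.IsSec (τ j) x) (hli : LinearIndependent 𝕂 fun j => τ j x) :
    ∃ V, IsOpen V ∧ x ∈ V ∧ ∃ (r : ℕ) (σ : Fin r → ∀ x, S.Fiber x) (g : ι → Fin r),
      S.IsFrame 𝕜 E n V σ ∧ Function.Injective g ∧ ∀ j, σ (g j) = τ j := by
  obtain ⟨U, hU, hx, r, e, he⟩ := hS x
  have := he.finiteDimensional hx
  have := Fintype.ofFinite ι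
  obtain ⟨m, u, hu, hu'⟩ := exists_sum_basis hli
  -- Complete to a basis at the single point `x` and extend the new vectors to sections;
  -- `exists_isFrame` turns this into a frame nearby.
  choose ρ hρ hρu using fun k => hS.exists_isSec x (u k)
  have hcard : Fintype.card (ι ⊕ Fin m) = r := by
    rw [← finrank_span_eq_card hu, hu', finrank_top, he.finrank_eq hx]
  let ε := Fintype.equivFinOfCardEq hcard
  let σ : Fin r → ∀ x, S.Fiber x := fun k => Sum.elim τ ρ (ε.symm k)
  have hσ : ∀ k, S.IsSec (σ k) x := by
    intro k
    rcases h : ε.symm k with j | j <;> simp only [σ, h, Sum.elim_inl, Sum.elim_inr]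
    exacts [hτ j, hρ j]
  have hσli : LinearIndependent 𝕂 fun k => σ k x := by
    have : (fun k => σ k x) = Sum.elim (fun j => τ j x) u ∘ ε.symm := by
      funext k
      rcases h : ε.symm k with j | j <;> simp [σ, h, hρu]
    rw [this]
    exact hu.comp _ ε.symm.injective
  obtain ⟨V, hV, hxV, -, hσV⟩ := he.exists_isFrame hU hx hσ hσli
  exact ⟨V, hV, hxV, r, σ, fun j => ε (Sum.inl j), hσV,
    ε.injective.comp Sum.inl_injective, fun j => by simp [σ]⟩

theorem IsLocallyFree.eventually_linearIndependent {ι : Type*} [Finite ι]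
    {τ : ι → ∀ x, S.Fiber x} (hτ : ∀ j, S.IsSec (τ j) x)
    (hli : LinearIndependent 𝕂 fun j => τ j x) :
    ∀ᶠ y in 𝓝 x, LinearIndependent 𝕂 fun j => τ j y := by
  obtain ⟨V, hV, hxV, r, σ, g, hσ, hg, hgτ⟩ := hS.exists_isFrame_extending hτ hli
  filter_upwards [hV.mem_nhds hxV] with y hy
  simpa only [Function.comp_def, hgτ] using (hσ.1 y hy).1.comp g hg

end LocallyFree

/-! ### Families of subspaces of constant rank -/

/-- The subspaces `P y` have constant dimension near `x`, and every vector of `P x` extends to a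
section with values in `P`. -/
def IsRegularAt (S : ModFamily 𝕂 X) (P : ∀ x, Submodule 𝕂 (S.Fiber x)) (x : X) : Prop :=
  (∀ᶠ y in 𝓝 x, finrank 𝕂 (P y) = finrank 𝕂 (P x)) ∧
    ∀ v ∈ P x, ∃ s, S.IsSec s x ∧ s x = v ∧ ∀ᶠ y in 𝓝 x, s y ∈ P y

section Regular

open scoped Matrix

variable (hS : S.IsLocallyFree 𝕜 E n) {P : ∀ x, Submodule 𝕂 (S.Fiber x)}
include hS

/-- Sections independent at `x` stay independent nearby, so their span inside `P y` keeps the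
dimension it has at `x`, which is that of `P y`. -/
theorem IsLocallyFree.eventually_eq_span {ι : Type*} [Fintype ι] {τ : ι → ∀ x, S.Fiber x}
    (hP : ∀ᶠ y in 𝓝 x, finrank 𝕂 (P y) = finrank 𝕂 (P x))
    (hτ : ∀ j, S.IsSec (τ j) x) (hτP : ∀ᶠ y in 𝓝 x, ∀ j, τ j y ∈ P y)
    (hli : LinearIndependent 𝕂 fun j => τ j x)
    (hx : P x = Submodule.span 𝕂 (Set.range fun j => τ j x)) :
    ∀ᶠ y in 𝓝 x, P y = Submodule.span 𝕂 (Set.range fun j => τ j y) := by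
  filter_upwards [hP, hτP, hS.eventually_linearIndependent hτ hli] with y h1 h2 h3
  have := hS.finiteDimensional y
  symm
  refine Submodule.eq_of_le_of_finrank_eq (Submodule.span_le.2 ?_) ?_
  · rintro _ ⟨j, rfl⟩
    exact h2 j
  · rw [h1, hx, finrank_span_eq_card h3, finrank_span_eq_card hli]

/-- Independent sections of a regular family extend to a frame of this family. -/
theorem IsLocallyFree.exists_frame_of_isRegularAt (hP : S.IsRegularAt P x) {ι : Type*} [Finite ι]
    {τ : ι → ∀ x, S.Fiber x} (hτ : ∀ j, S.IsSec (τ j) x)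
    (hτP : ∀ j, ∀ᶠ y in 𝓝 x, τ j y ∈ P y) (hli : LinearIndependent 𝕂 fun j => τ j x) :
    ∃ (m : ℕ) (ρ : Fin m → ∀ x, S.Fiber x), (∀ k, S.IsSec (ρ k) x) ∧
      (∀ k, ∀ᶠ y in 𝓝 x, ρ k y ∈ P y) ∧
      LinearIndependent 𝕂 (fun j => Sum.elim τ ρ j x) ∧
      ∀ᶠ y in 𝓝 x, P y = Submodule.span 𝕂 (Set.range fun j => Sum.elim τ ρ j y) := by
  have := hS.finiteDimensional x
  have := Fintype.ofFinite ι
  let v : ι → P x := fun j => ⟨τ j x, (hτP j).self_of_nhds⟩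
  have hv : LinearIndependent 𝕂 v := LinearIndependent.of_comp (P x).subtype hli
  obtain ⟨m, u, hu, hu'⟩ := exists_sum_basis hv
  choose ρ hρ hρu hρP using fun k => hP.2 (u k) (u k).2
  have hρx : (fun j => Sum.elim τ ρ j x) = (P x).subtype ∘ Sum.elim v u := by
    funext j
    rcases j with j | j <;> simp [v, hρu]
  have hli' : LinearIndependent 𝕂 (fun j => Sum.elim τ ρ j x) := by
    rw [hρx]
    exact hu.map' _ (Submodule.ker_subtype _)
  refine ⟨m, ρ, hρ, hρP, hli', hS.eventually_eq_span hP.1 ?_ ?_ hli' ?_⟩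
  · rintro (j | j)
    exacts [hτ j, hρ j]
  · filter_upwards [eventually_all.2 hτP, eventually_all.2 hρP] with y h1 h2
    rintro (j | j)
    exacts [h1 j, h2 j]
  · rw [hρx, Set.range_comp, Submodule.span_image, hu', Submodule.map_top, Submodule.range_subtype]

section Span

variable {ι : Type*} [Fintype ι] {τ : ι → ∀ x, S.Fiber x} (hτ : ∀ j, S.IsSec (τ j) x)
  (hP : ∀ᶠ y in 𝓝 x, P y = Submodule.span 𝕂 (Set.range fun j => τ j y))
  (hr : ∀ᶠ y in 𝓝 x, finrank 𝕂 (P y) = finrank 𝕂 (P x))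
include hτ hP hr

theorem IsLocallyFree.isRegularAt_span : S.IsRegularAt P x := by
  refine ⟨hr, fun v hv => ?_⟩
  rw [hP.self_of_nhds] at hv
  obtain ⟨c, hc⟩ := (Submodule.mem_span_range_iff_exists_fun 𝕂).1 hv
  refine ⟨fun y => ∑ j, c j • τ j y, hS.isSec_sum (fun j _ => isFun_const _ x) fun j _ => hτ j, hc,
    ?_⟩
  filter_upwards [hP] with y hy
  rw [hy]
  exact Submodule.sum_mem _ fun j _ => Submodule.smul_mem _ _ (Submodule.subset_span ⟨j, rfl⟩)

/-- Sections of a span of constant rank are combinations of the generators. -/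
theorem IsLocallyFree.exists_coeff_of_mem_span {s : ∀ x, S.Fiber x} (hs : S.IsSec s x)
    (hsP : ∀ᶠ y in 𝓝 x, s y ∈ P y) :
    ∃ c : ι → X → 𝕂, (∀ j, IsFun 𝕜 E n (c j) x) ∧ ∀ᶠ y in 𝓝 x, s y = ∑ j, c j y • τ j y := by
  -- Select generators forming a basis of `P x`. By constancy of the rank they still span `P y`
  -- nearby and are part of a frame; the discarded generators get coefficient zero.
  obtain ⟨κ, a, ha, hsp, hli⟩ := exists_linearIndependent' 𝕂 fun j => τ j x
  have : Finite κ := Finite.of_injective a ha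
  have := Fintype.ofFinite κ
  have hPa : ∀ᶠ y in 𝓝 x, P y = Submodule.span 𝕂 (Set.range fun k => τ (a k) y) := by
    refine hS.eventually_eq_span hr (fun k => hτ (a k)) ?_ hli ?_
    · filter_upwards [hP] with y hy k
      rw [hy]
      exact Submodule.subset_span ⟨a k, rfl⟩
    · rw [hP.self_of_nhds, ← hsp]
      rfl
  obtain ⟨V, hV, hxV, r, σ, g, hσ, hg, hgτ⟩ := hS.exists_isFrame_extending (fun k => hτ (a k)) hli
  obtain ⟨b, hb, hsb⟩ := (hσ.2 x hxV s).1 hs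
  classical
  refine ⟨fun j y => ∑ k, if a k = j then b (g k) y else 0, fun j => IsFun.sum fun k _ => ?_, ?_⟩
  · by_cases h : a k = j
    · simpa [h] using hb (g k)
    · simpa [h] using isFun_const _ x
  filter_upwards [hV.mem_nhds hxV, hsb, hPa, hsP] with y h1 h2 h3 h4
  have h5 : (Set.range fun k => τ (a k) y) = (fun j => σ j y) '' Set.range g := by
    rw [← Set.range_comp]
    simp only [Function.comp_def, hgτ]
  rw [h3, h5, h2] at h4
  have h6 : ∀ j, j ∉ Set.range g → b j y • σ j y = 0 := fun j hj => by
    rw [coeff_eq_zero_of_mem_span (hσ.1 y h1).1 (c := fun j => b j y) h4 hj, zero_smul]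
  rw [h2]
  simp only [Finset.sum_smul, ite_smul, zero_smul]
  rw [Finset.sum_comm]
  simp only [Finset.sum_ite_eq, Finset.mem_univ, if_true, ← hgτ]
  rw [← Finset.sum_subset (Finset.subset_univ (Finset.univ.image g)) (fun j _ hj => h6 j (by
    simpa using hj)), Finset.sum_image fun a _ b _ h => hg h]

end Span

/-- The kernel of finitely many linear forms depending smoothly on the point is regular if its
dimension is constant. -/
theorem IsLocallyFree.isRegularAt_ker {m : ℕ} {φ : Fin m → ∀ x, S.Fiber x →ₗ[𝕂] 𝕂}
    (hφ : ∀ k s, S.IsSec s x → IsFun 𝕜 E n (fun y => φ k y (s y)) x)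
    (hP : ∀ᶠ y in 𝓝 x, ∀ v, v ∈ P y ↔ ∀ k, φ k y v = 0)
    (hr : ∀ᶠ y in 𝓝 x, finrank 𝕂 (P y) = finrank 𝕂 (P x)) : S.IsRegularAt P x := by
  refine ⟨hr, fun v hv => ?_⟩
  obtain ⟨U, hU, hx, r, e, he⟩ := hS x
  let M : X → Matrix (Fin m) (Fin r) 𝕂 := fun y => Matrix.of fun k j => φ k y (e j y)
  have hM : ∀ k j, IsFun 𝕜 E n (fun y => M y k j) x := fun k j => hφ k _ (he.isSec hx j)
  obtain ⟨g, hg⟩ := exists_generalized_inverse (M x).mulVecLin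
  let R : Matrix (Fin r) (Fin m) 𝕂 := LinearMap.toMatrix' g
  have hR : ∀ c, M x *ᵥ (R *ᵥ (M x *ᵥ c)) = M x *ᵥ c := by
    intro c
    rw [show R *ᵥ (M x *ᵥ c) = g (M x *ᵥ c) from LinearMap.toMatrix'_mulVec g _]
    exact hg c
  -- If `M y w = 0`, then `T y w = w - R (M x w)`, and `M x R M x = M x` puts this in `ker (M x)`.
  -- Since `T x = 1`, `T y` is invertible near `x`; as both kernels have the same dimension, it maps
  -- `ker (M y)` onto `ker (M x)`. So `(T y)⁻¹ c₀` lies in `ker (M y)` and depends smoothly on `y`.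
  let T : X → Matrix (Fin r) (Fin r) 𝕂 := fun y => 1 + R * (M y - M x)
  have hTx : T x = 1 := by simp [T]
  have hT : ∀ a b, IsFun 𝕜 E n (fun y => T y a b) x := by
    intro a b
    simp only [T, Matrix.add_apply, Matrix.mul_apply, Matrix.sub_apply]
    exact (isFun_const _ x).add (IsFun.sum fun k _ => (isFun_const _ x).mul
      ((hM k b).sub (isFun_const _ x)))
  have hTx0 : (T x).det ≠ 0 := by simp [hTx]
  let c₀ : Fin r → 𝕂 := fun j => (he.basis hx).repr v j
  let c : Fin r → X → 𝕂 := fun j y => ((T y)⁻¹ *ᵥ c₀) j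
  have hc : ∀ j, IsFun 𝕜 E n (c j) x := fun j => by
    simp only [c, Matrix.mulVec, dotProduct]
    exact IsFun.sum fun k _ => (isFun_matrix_inv hT hTx0 j k).mul (isFun_const _ x)
  have hker : ∀ y, (∀ v, v ∈ P y ↔ ∀ k, φ k y v = 0) → ∀ v (hy : y ∈ U),
      v ∈ P y ↔ M y *ᵥ (he.basis hy).equivFun v = 0 := by
    intro y hyP v hy
    rw [hyP, funext_iff]
    refine forall_congr' fun k => ?_
    have h1 : φ k y v = (M y *ᵥ (he.basis hy).equivFun v) k := by
      conv_lhs => rw [← (he.basis hy).sum_equivFun v]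
      simp [Matrix.mulVec, dotProduct, M, he.basis_apply, mul_comm]
    rw [h1]
    rfl
  have hmap : ∀ y (hy : y ∈ U), (∀ v, v ∈ P y ↔ ∀ k, φ k y v = 0) →
      (P y).map ((he.basis hy).equivFun : S.Fiber y →ₗ[𝕂] (Fin r → 𝕂)) =
        LinearMap.ker (M y).mulVecLin := by
    intro y hy hyP
    ext w
    simp only [Submodule.mem_map, LinearMap.mem_ker, Matrix.mulVecLin_apply]
    constructor
    · rintro ⟨v, hv, rfl⟩
      exact (hker y hyP v hy).1 hv
    · intro hw
      exact ⟨(he.basis hy).equivFun.symm w, (hker y hyP _ hy).2 (by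
        rwa [LinearEquiv.apply_symm_apply]), LinearEquiv.apply_symm_apply _ w⟩
  have hcx : (fun j => c j x) = c₀ := by
    funext j
    simp [c, hTx]
  refine ⟨fun y => ∑ j, c j y • e j y, he.isSec_sum hx hc, ?_, ?_⟩
  · have h1 : ∀ j, c j x = c₀ j := fun j => congrFun hcx j
    conv_rhs => rw [← (he.basis hx).sum_repr v]
    simp only [h1, c₀, he.basis_apply]
  filter_upwards [hU.mem_nhds hx, hP, hr, (isFun_det hT).eventually_ne hTx0] with y h1 h2 h3 h4
  have hTM : ∀ w, M y *ᵥ w = 0 → M x *ᵥ (T y *ᵥ w) = 0 := by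
    intro w hw
    have h5 : T y *ᵥ w = w - R *ᵥ (M x *ᵥ w) := by
      simp only [T, Matrix.add_mulVec, Matrix.one_mulVec, ← Matrix.mulVec_mulVec,
        Matrix.sub_mulVec, hw, zero_sub, Matrix.mulVec_neg]
      exact (sub_eq_add_neg _ _).symm
    rw [h5, Matrix.mulVec_sub, hR, sub_self]
  let L : LinearMap.ker (M y).mulVecLin →ₗ[𝕂] LinearMap.ker (M x).mulVecLin :=
    (T y).mulVecLin.restrict fun w hw => hTM w hw
  have hLinj : Function.Injective L := by
    intro a b hab
    have h5 : T y *ᵥ a.1 = T y *ᵥ b.1 := congrArg Subtype.val hab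
    exact Subtype.ext (Matrix.mulVec_injective_of_isUnit
      ((Matrix.isUnit_iff_isUnit_det _).2 (isUnit_iff_ne_zero.2 h4)) h5)
  have hfr : finrank 𝕂 (LinearMap.ker (M y).mulVecLin) =
      finrank 𝕂 (LinearMap.ker (M x).mulVecLin) := by
    rw [← hmap y h1 h2, ← hmap x hx hP.self_of_nhds, LinearEquiv.finrank_map_eq,
      LinearEquiv.finrank_map_eq, h3]
  have hLsurj := (LinearMap.injective_iff_surjective_of_finrank_eq_finrank hfr).1 hLinj
  obtain ⟨w, hw⟩ := hLsurj ⟨c₀, (hker x hP.self_of_nhds v hx).1 hv⟩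
  have hw' : T y *ᵥ w.1 = c₀ := congrArg Subtype.val hw
  have hcy : (fun j => c j y) = w.1 := by
    have h6 : (fun j => c j y) = (T y)⁻¹ *ᵥ c₀ := rfl
    rw [h6, ← hw', Matrix.mulVec_mulVec, Matrix.nonsing_inv_mul _ (isUnit_iff_ne_zero.2 h4),
      Matrix.one_mulVec]
  refine (hker y h2 _ h1).2 ?_
  have h7 : ∑ j, c j y • e j y = (he.basis h1).equivFun.symm fun j => c j y := by
    rw [Basis.equivFun_symm_apply]
    simp only [he.basis_apply]
  rw [h7, LinearEquiv.apply_symm_apply, hcy]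
  exact w.2

end Regular

end ModFamily

namespace ModFamily

variable {𝕜 : Type*} [RCLike 𝕜] {𝕂 : Type*} [RCLike 𝕂] [NormedAlgebra 𝕜 𝕂]
  {E : Type*} [NormedAddCommGroup E] [NormedSpace 𝕜 E] {n : WithTop ℕ∞}
  {X : Type*} [TopologicalSpace X] [ChartedSpace E X]
  {S : ModFamily 𝕂 X} {x : X}

/-! ### Sub-bundles -/

theorem IsSubbundle.isLocallyFree {K : ∀ x, Submodule 𝕂 (S.Fiber x)}
    (hK : S.IsSubbundle 𝕜 E n K) : S.IsLocallyFree 𝕜 E n := by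
  intro x
  obtain ⟨U, hU, hx, r, e, J, he, hJ⟩ := hK x
  exact ⟨U, hU, hx, r, e, he⟩

theorem IsSubbundle.isRegularAt {K : ∀ x, Submodule 𝕂 (S.Fiber x)}
    (hK : S.IsSubbundle 𝕜 E n K) (x : X) : S.IsRegularAt K x := by
  obtain ⟨U, hU, hx, r, e, J, he, hJ⟩ := hK x
  have := Fintype.ofFinite J
  have hspan : ∀ y ∈ U, K y = Submodule.span 𝕂 (Set.range fun j : J => e j y) := by
    intro y hy
    rw [hJ y hy, Set.image_eq_range]
  have hrk : ∀ y ∈ U, finrank 𝕂 (K y) = Fintype.card J := by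
    intro y hy
    rw [hspan y hy]
    exact finrank_span_eq_card ((he.1 y hy).1.comp (fun j : J => j.1) Subtype.val_injective)
  refine hK.isLocallyFree.isRegularAt_span (τ := fun j : J => e j) (fun j => he.isSec hx j) ?_ ?_
  · filter_upwards [hU.mem_nhds hx] with y hy using hspan y hy
  · filter_upwards [hU.mem_nhds hx] with y hy
    rw [hrk y hy, hrk x hx]

/-- A chain of three regular families of subspaces has an adapted frame. -/
theorem IsLocallyFree.exists_adapted_frame (hS : S.IsLocallyFree 𝕜 E n)
    {C K A : ∀ x, Submodule 𝕂 (S.Fiber x)} (hC : S.IsRegularAt C x) (hK : S.IsRegularAt K x)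
    (hA : S.IsRegularAt A x) (hCK : ∀ y, C y ≤ K y) (hKA : ∀ y, K y ≤ A y) :
    ∃ V, IsOpen V ∧ x ∈ V ∧ ∃ (r : ℕ) (e : Fin r → ∀ x, S.Fiber x) (J₁ J₂ J₃ : Set (Fin r)),
      S.IsFrame 𝕜 E n V e ∧ J₁ ⊆ J₂ ∧ J₂ ⊆ J₃ ∧ ∀ y ∈ V,
        C y = Submodule.span 𝕂 ((fun j => e j y) '' J₁) ∧
        K y = Submodule.span 𝕂 ((fun j => e j y) '' J₂) ∧
        A y = Submodule.span 𝕂 ((fun j => e j y) '' J₃) := by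
  -- The frame grows from the empty family, indexed by `Fin 0`, successively through `C`, `K`, `A`
  -- and finally all of `S`.
  obtain ⟨a, ρ₁, hρ₁, hρ₁C, hli₁, hC'⟩ := hS.exists_frame_of_isRegularAt hC
    (τ := fun j : Fin 0 => j.elim0) (fun j => j.elim0) (fun j => j.elim0)
    (linearIndependent_empty_type)
  let τ₁ : Fin 0 ⊕ Fin a → ∀ x, S.Fiber x := Sum.elim (fun j => j.elim0) ρ₁
  have hτ₁ : ∀ j, S.IsSec (τ₁ j) x := by rintro (j | j); exacts [j.elim0, hρ₁ j]
  have hτ₁C : ∀ j, ∀ᶠ y in 𝓝 x, τ₁ j y ∈ C y := by rintro (j | j); exacts [j.elim0, hρ₁C j]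
  obtain ⟨b, ρ₂, hρ₂, hρ₂K, hli₂, hK'⟩ := hS.exists_frame_of_isRegularAt hK (τ := τ₁) hτ₁
    (fun j => (hτ₁C j).mono fun y hy => hCK y hy) hli₁
  let τ₂ : (Fin 0 ⊕ Fin a) ⊕ Fin b → ∀ x, S.Fiber x := Sum.elim τ₁ ρ₂
  have hτ₂ : ∀ j, S.IsSec (τ₂ j) x := by rintro (j | j); exacts [hτ₁ j, hρ₂ j]
  have hτ₂K : ∀ j, ∀ᶠ y in 𝓝 x, τ₂ j y ∈ K y := by
    rintro (j | j)
    exacts [(hτ₁C j).mono fun y hy => hCK y hy, hρ₂K j]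
  obtain ⟨c, ρ₃, hρ₃, hρ₃A, hli₃, hA'⟩ := hS.exists_frame_of_isRegularAt hA (τ := τ₂) hτ₂
    (fun j => (hτ₂K j).mono fun y hy => hKA y hy) hli₂
  let τ₃ : ((Fin 0 ⊕ Fin a) ⊕ Fin b) ⊕ Fin c → ∀ x, S.Fiber x := Sum.elim τ₂ ρ₃
  have hτ₃ : ∀ j, S.IsSec (τ₃ j) x := by rintro (j | j); exacts [hτ₂ j, hρ₃ j]
  obtain ⟨U, hU, hxU, r, σ, g, hσ, hg, hgτ⟩ := hS.exists_isFrame_extending hτ₃ hli₃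
  obtain ⟨W, hW, hWo, hxW⟩ := eventually_nhds_iff.1 (hC'.and (hK'.and hA'))
  refine ⟨U ∩ W, hU.inter hWo, ⟨hxU, hxW⟩, r, σ, Set.range fun j => g (Sum.inl (Sum.inl j)),
    Set.range fun j => g (Sum.inl j), Set.range g, hσ.mono Set.inter_subset_left, ?_, ?_, ?_⟩
  · rintro _ ⟨j, rfl⟩
    exact ⟨Sum.inl j, rfl⟩
  · rintro _ ⟨j, rfl⟩
    exact ⟨Sum.inl j, rfl⟩
  · intro y hy
    obtain ⟨h1, h2, h3⟩ := hW y hy.2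
    refine ⟨h1.trans ?_, h2.trans ?_, h3.trans ?_⟩ <;> rw [← Set.range_comp] <;>
      simp only [Function.comp_def, hgτ] <;> rfl

/-! ### Subquotients -/

/-- `P` is the subquotient `A / C` of `S`, through the linear maps `F`, which matter only on `A`. -/
structure IsSubquotient (S P : ModFamily 𝕂 X) (A C : ∀ x, Submodule 𝕂 (S.Fiber x))
    (F : ∀ x, S.Fiber x →ₗ[𝕂] P.Fiber x) : Prop where
  le : ∀ x, C x ≤ A x
  map_eq_top : ∀ x, (A x).map (F x) = ⊤
  map_eq_zero_iff : ∀ x, ∀ v ∈ A x, F x v = 0 ↔ v ∈ C x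
  isSec_iff : ∀ x s, P.IsSec s x ↔
    ∃ σ, S.IsSec σ x ∧ ∀ᶠ y in 𝓝 x, σ y ∈ A y ∧ s y = F y (σ y)

variable {P : ModFamily 𝕂 X} {A C : ∀ x, Submodule 𝕂 (S.Fiber x)}
  {F : ∀ x, S.Fiber x →ₗ[𝕂] P.Fiber x}

/-- In a frame adapted to `C ⊆ K ⊆ A`, with index sets `J₁ ⊆ J₂ ⊆ J₃`, the images of the `e j` with
`j ∈ J₃ \ J₁` form a frame of `A / C`, and those with moreover `j ∈ J₂` span the image of `K`. -/
theorem IsSubquotient.isSubbundle_map (h : IsSubquotient S P A C F) (hS : S.IsLocallyFree 𝕜 E n)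
    (hA : ∀ x, S.IsRegularAt A x) (hC : ∀ x, S.IsRegularAt C x)
    {K : ∀ x, Submodule 𝕂 (S.Fiber x)} (hK : S.IsSubbundle 𝕜 E n K) (hCK : ∀ x, C x ≤ K x)
    (hKA : ∀ x, K x ≤ A x) : P.IsSubbundle 𝕜 E n fun x => (K x).map (F x) := by
  intro x
  obtain ⟨V, hV, hxV, r, e, J₁, J₂, J₃, he, h12, h23, hJ⟩ :=
    hS.exists_adapted_frame (hC x) (hK.isRegularAt x) (hA x) hCK hKA
  classical
  let I := {j : Fin r // j ∈ J₃ \ J₁}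
  have heA : ∀ y ∈ V, ∀ j ∈ J₃, e j y ∈ A y := fun y hy j hj => by
    rw [(hJ y hy).2.2]
    exact Submodule.subset_span ⟨j, hj, rfl⟩
  have heC : ∀ y ∈ V, ∀ j ∈ J₁, F y (e j y) = 0 := fun y hy j hj => by
    rw [h.map_eq_zero_iff y _ (heA y hy j (h23 (h12 hj))), (hJ y hy).1]
    exact Submodule.subset_span ⟨j, hj, rfl⟩
  let ε := Fintype.equivFin I
  let η : Fin (Fintype.card I) → ∀ x, P.Fiber x := fun k y => F y (e (ε.symm k).1 y)
  have hsum : ∀ y (c : Fin r → 𝕂), (∀ j, j ∉ J₃ \ J₁ → c j • F y (e j y) = 0) →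
      ∑ j, c j • F y (e j y) = ∑ k, c (ε.symm k).1 • η k y := by
    intro y c hc
    rw [ε.symm.sum_comp fun j : I => c j.1 • F y (e j.1 y)]
    rw [← Finset.sum_subtype (Finset.univ.filter fun j => j ∈ J₃ \ J₁) (by simp)
      fun j => c j • F y (e j y)]
    symm
    exact Finset.sum_subset (Finset.filter_subset _ _) fun j _ hj => hc j (by simpa using hj)
  have hspan : ∀ y ∈ V, ∀ J, J ⊆ J₃ →
      (Submodule.span 𝕂 ((fun j => e j y) '' J)).map (F y) =
        Submodule.span 𝕂 ((fun k => η k y) '' {k | (ε.symm k).1 ∈ J}) := by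
    intro y hy J hJ3
    rw [Submodule.map_span]
    refine le_antisymm (Submodule.span_le.2 ?_) (Submodule.span_mono ?_)
    · rintro _ ⟨_, ⟨j, hj, rfl⟩, rfl⟩
      by_cases hj1 : j ∈ J₁
      · simp only [heC y hy j hj1]
        exact Submodule.zero_mem _
      · refine Submodule.subset_span ⟨ε ⟨j, hJ3 hj, hj1⟩, ?_, ?_⟩ <;> simp [η, hj]
    · rintro _ ⟨k, hk, rfl⟩
      exact ⟨_, ⟨_, hk, rfl⟩, rfl⟩
  refine ⟨V, hV, hxV, _, η, {k | (ε.symm k).1 ∈ J₂}, ⟨fun y hy => ⟨?_, ?_⟩, fun y hy s => ?_⟩,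
    fun y hy => ?_⟩
  · have h1 : LinearIndependent 𝕂 fun j : I => e j.1 y :=
      (he.1 y hy).1.comp _ Subtype.val_injective
    have h2 : LinearIndependent 𝕂 fun j : I => F y (e j.1 y) := by
      refine h1.map (f := F y) (Submodule.disjoint_def.2 fun v hv hv0 => ?_)
      have h3 : (Set.range fun j : I => e j.1 y) = (fun j => e j y) '' (J₃ \ J₁) :=
        (Set.image_eq_range (fun j => e j y) (J₃ \ J₁)).symm
      rw [h3] at hv
      have hvA : v ∈ A y := by
        rw [(hJ y hy).2.2]
        exact Submodule.span_mono (Set.image_mono Set.sdiff_subset) hv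
      have hvC := (h.map_eq_zero_iff y v hvA).1 hv0
      rw [(hJ y hy).1] at hvC
      exact Submodule.disjoint_def.1 ((he.1 y hy).1.disjoint_span_image Set.disjoint_sdiff_left)
        v hv hvC
    exact h2.comp _ ε.symm.injective
  · have h1 := hspan y hy J₃ subset_rfl
    rw [← (hJ y hy).2.2, h.map_eq_top] at h1
    rw [eq_top_iff, h1]
    exact Submodule.span_mono (Set.image_subset_range _ _)
  · rw [h.isSec_iff]
    constructor
    · rintro ⟨σ, hσ, hs⟩
      obtain ⟨c, hc, hσc⟩ := (he.2 y hy σ).1 hσ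
      refine ⟨fun k => c (ε.symm k).1, fun k => hc _, ?_⟩
      filter_upwards [hV.mem_nhds hy, hs, hσc] with w h1 h2 h3
      rw [h2.2, h3, map_sum]
      simp only [map_smul]
      -- The terms with `j ∈ J₁` are killed by `F`; those with `j ∉ J₃` have zero coefficient
      -- because `σ` takes values in `A`.
      refine hsum w (fun j => c j w) fun j hj => ?_
      by_cases hj3 : j ∈ J₃
      · rw [heC w h1 j (by_contra fun hj1 => hj ⟨hj3, hj1⟩), smul_zero]
      · have h4 := h2.1
        rw [h3, (hJ w h1).2.2] at h4
        rw [coeff_eq_zero_of_mem_span (he.1 w h1).1 (c := fun j => c j w) h4 hj3, zero_smul]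
    · rintro ⟨c, hc, hs⟩
      refine ⟨fun w => ∑ k, c k w • e (ε.symm k).1 w,
        hS.isSec_sum (fun k _ => hc k) fun k _ => he.isSec hy _, ?_⟩
      filter_upwards [hV.mem_nhds hy, hs] with w h1 h2
      refine ⟨Submodule.sum_mem _ fun k _ => Submodule.smul_mem _ _
        (heA w h1 _ (ε.symm k).2.1), ?_⟩
      rw [h2, map_sum]
      simp only [map_smul, η]
  · change (K y).map (F y) = _
    rw [(hJ y hy).2.1]
    exact hspan y hy J₂ h23

/-- Lifts of a local frame of `D`, together with a local frame of `C`, are a local frame of the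
preimage. -/
theorem IsSubquotient.isSubbundle_comap (h : IsSubquotient S P A C F)
    (hS : S.IsLocallyFree 𝕜 E n) (hC : ∀ x, S.IsRegularAt C x)
    {D : ∀ x, Submodule 𝕂 (P.Fiber x)} (hD : P.IsSubbundle 𝕜 E n D) :
    S.IsSubbundle 𝕜 E n fun x => A x ⊓ (D x).comap (F x) := by
  have key : ∀ x, S.IsRegularAt (fun x => A x ⊓ (D x).comap (F x)) x := by
    intro x
    obtain ⟨U, hU, hxU, r, e, J, he, hJ⟩ := hD x
    have := Fintype.ofFinite J
    choose σ hσ hσF using fun j : J => (h.isSec_iff x (e j)).1 (he.isSec hxU j)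
    obtain ⟨a, ρ, hρ, hρC, hρli, hCρ⟩ := hS.exists_frame_of_isRegularAt (hC x)
      (τ := fun j : Fin 0 => j.elim0) (fun j => j.elim0) (fun j => j.elim0)
      (linearIndependent_empty_type)
    have hρli' : LinearIndependent 𝕂 fun k => ρ k x := hρli.comp Sum.inr Sum.inr_injective
    have hτ : ∀ j, S.IsSec (Sum.elim σ ρ j) x := by
      rintro (j | j)
      exacts [hσ j, hρ j]
    have hev : ∀ᶠ y in 𝓝 x, y ∈ U ∧ (∀ j, σ j y ∈ A y ∧ e j y = F y (σ j y)) ∧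
        (∀ k, ρ k y ∈ C y) ∧ C y ≤ Submodule.span 𝕂 (Set.range fun j => Sum.elim σ ρ j y) := by
      filter_upwards [hU.mem_nhds hxU, eventually_all.2 hσF, eventually_all.2 hρC, hCρ] with
        y h1 h2 h3 h4
      refine ⟨h1, h2, h3, h4.trans_le (Submodule.span_le.2 ?_)⟩
      rintro _ ⟨j | j, rfl⟩
      exacts [j.elim0, Submodule.subset_span ⟨Sum.inr j, rfl⟩]
    -- A combination of the lifts lying in `C` is killed by `F`, hence gives a relation among the
    -- independent `e j`; so the two spans are disjoint.
    have hli : LinearIndependent 𝕂 fun j => Sum.elim σ ρ j x := by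
      obtain ⟨-, h2, h3, -⟩ := hev.self_of_nhds
      have hFσ : F x ∘ (fun j => σ j x) = fun j : J => e j x := funext fun j => (h2 j).2.symm
      have heli : LinearIndependent 𝕂 fun j : J => e j x :=
        (he.1 x hxU).1.comp _ Subtype.val_injective
      refine linearIndependent_sum.2 ⟨LinearIndependent.of_comp (F x) (by
        change LinearIndependent 𝕂 (F x ∘ fun j => σ j x)
        rwa [hFσ]), hρli', Submodule.disjoint_def.2 fun v hv hv' => ?_⟩
      obtain ⟨c, rfl⟩ := (Submodule.mem_span_range_iff_exists_fun 𝕂).1 hv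
      have hvC : ∑ j, c j • σ j x ∈ C x := by
        refine (Submodule.span_le.2 ?_) hv'
        rintro _ ⟨k, rfl⟩
        exact h3 k
      have h4 := (h.map_eq_zero_iff x _ (h.le x hvC)).2 hvC
      rw [map_sum] at h4
      simp only [map_smul, ← (h2 _).2] at h4
      refine Finset.sum_eq_zero fun j _ => ?_
      rw [Fintype.linearIndependent_iff.1 heli c h4 j, zero_smul]
    have hspan : ∀ᶠ y in 𝓝 x, A y ⊓ (D y).comap (F y) =
        Submodule.span 𝕂 (Set.range fun j => Sum.elim σ ρ j y) := by
      filter_upwards [hev] with y ⟨h1, h2, h3, h4⟩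
      have hDy : D y = Submodule.span 𝕂 (Set.range fun j : J => e j y) := by
        rw [hJ y h1, Set.image_eq_range]
      refine le_antisymm ?_ (Submodule.span_le.2 ?_)
      · rintro v ⟨hvA, hvD⟩
        rw [SetLike.mem_coe, Submodule.mem_comap, hDy,
          Submodule.mem_span_range_iff_exists_fun] at hvD
        obtain ⟨c, hc⟩ := hvD
        have hσA : ∑ j, c j • σ j y ∈ A y :=
          Submodule.sum_mem _ fun j _ => Submodule.smul_mem _ _ (h2 j).1
        have h5 : v - ∑ j, c j • σ j y ∈ C y := by
          rw [← h.map_eq_zero_iff y _ (Submodule.sub_mem _ hvA hσA), map_sub, map_sum, ← hc]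
          simp only [map_smul, ← (h2 _).2, sub_self]
        have h6 : ∑ j, c j • σ j y ∈ Submodule.span 𝕂 (Set.range fun j => Sum.elim σ ρ j y) :=
          Submodule.sum_mem _ fun j _ => Submodule.smul_mem _ _
            (Submodule.subset_span ⟨Sum.inl j, rfl⟩)
        simpa using Submodule.add_mem _ (h4 h5) h6
      · rintro _ ⟨j | k, rfl⟩
        · refine ⟨(h2 j).1, ?_⟩
          rw [SetLike.mem_coe, Submodule.mem_comap, hDy]
          exact Submodule.subset_span ⟨j, (h2 j).2⟩
        · have h5 := h.le y (h3 k)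
          refine ⟨h5, ?_⟩
          rw [SetLike.mem_coe, Submodule.mem_comap]
          have h6 := (h.map_eq_zero_iff y _ h5).2 (h3 k)
          exact h6 ▸ Submodule.zero_mem _
    refine hS.isRegularAt_span hτ hspan ?_
    filter_upwards [hspan, hS.eventually_linearIndependent hτ hli] with y h1 h2
    rw [h1, hspan.self_of_nhds, finrank_span_eq_card h2, finrank_span_eq_card hli]
  intro x
  -- The constant chain only serves to complete a frame of the preimage to a frame of `S`.
  obtain ⟨V, hV, hxV, r, e, J₁, _, _, he, -, -, hJ⟩ := hS.exists_adapted_frame (key x) (key x)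
    (key x) (fun _ => le_rfl) fun _ => le_rfl
  exact ⟨V, hV, hxV, r, e, J₁, he, fun y hy => (hJ y hy).1⟩

end ModFamily

section

variable {𝕜 : Type*} [RCLike 𝕜] {𝕂 : Type*} [RCLike 𝕂] [NormedAlgebra 𝕜 𝕂] {n : WithTop ℕ∞}
  {E : Type*} [NormedAddCommGroup E] [NormedSpace 𝕜 E]
  {X : Type*} [TopologicalSpace X] [ChartedSpace E X]
  {E' : Type*} [NormedAddCommGroup E'] [NormedSpace 𝕜 E']
  {Z : Type*} [TopologicalSpace Z] [ChartedSpace E' Z] {i : Z → X} {z : Z}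

/-! ### Inverse images of locally free sheaves -/

section Pullback

variable {S : ModFamily 𝕂 X} (hi : ContMDiff 𝓘(𝕜, E') 𝓘(𝕜, E) n i)
  (hS : S.IsLocallyFree 𝕜 E n)

theorem ModFamily.isSec_pullback_comp {Y : Type*} {S : ModFamily 𝕂 Y} {i : Z → Y} {q : ∀ x, S.Fiber x}
    (hq : S.IsSec q (i z)) : (S.pullback 𝕜 n E' i).IsSec (fun w => q (i w)) z :=
  ⟨1, fun _ _ => 1, fun _ => q, fun _ => isFun_const 1 z, fun _ => hq,
    Eventually.of_forall fun w => by simp⟩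

include hi hS in
theorem ModFamily.IsLocallyFree.pullback : (S.pullback 𝕜 n E' i).IsLocallyFree 𝕜 E' n := by
  intro z
  obtain ⟨U, hU, hz, r, e, he⟩ := hS (i z)
  refine ⟨i ⁻¹' U, hU.preimage hi.continuous, hz, r, fun j w => e j (i w),
    fun w hw => he.1 (i w) hw, fun w hw σ => ⟨?_, ?_⟩⟩
  · rintro ⟨m, c, q, hc, hq, hσ⟩
    choose a ha hqa using fun j => (he.2 (i w) hw (q j)).1 (hq j)
    refine ⟨fun k v => ∑ j, c j v * a j k (i v), fun k => IsFun.sum fun j _ => (hc j).mul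
      ((ha j k).comp hi), ?_⟩
    filter_upwards [hσ, eventually_all.2 fun j => hi.continuous.continuousAt.eventually (hqa j)]
      with v h1 h2
    rw [h1]
    simp only [h2, Finset.smul_sum, smul_smul]
    rw [Finset.sum_comm]
    exact Finset.sum_congr rfl fun k _ => (Finset.sum_smul (M := S.Fiber (i v))).symm
  · rintro ⟨c, hc, hσ⟩
    exact ⟨r, c, e, hc, fun j => he.isSec hw j, hσ⟩

end Pullback

/-- It suffices to extend the coefficient functions from `Z` to `X`. This provides lifts of sections
of `i^{++}Q` to sections of `Q`. -/
theorem ModFamily.IsLocallyFree.exists_extension {S : ModFamily 𝕂 X}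
    (hS : S.IsLocallyFree 𝕜 E n) (hi : Manifold.IsImmersion 𝓘(𝕜, E') 𝓘(𝕜, E) n i)
    {σ : ∀ w, S.Fiber (i w)} (hσ : (S.pullback 𝕜 n E' i).IsSec σ z) :
    ∃ q, S.IsSec q (i z) ∧ ∀ᶠ w in 𝓝 z, σ w = q (i w) := by
  obtain ⟨m, c, q, hc, hq, hσ⟩ := hσ
  choose G hG hGc using fun j => exists_isFun_extension hi (hc j)
  refine ⟨fun y => ∑ j, G j y • q j y, hS.isSec_sum (fun j _ => hG j) fun j _ => hq j, ?_⟩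
  filter_upwards [hσ, eventually_all.2 hGc] with w h1 h2
  rw [h1]
  simp only [h2]

/-! ### The sub-bundles `π^†(N^∨_{Z|X})` and `π⁻¹(𝒯_Z)` -/

namespace CourantOps

variable (E') in
/-- The subspace of vectors of `i^*Q` whose anchor is tangent to `Z`. -/
def tangentSub (Q : CourantOps 𝕜 𝕂 E X) (i : Z → X) (z : Z) : Submodule 𝕂 (Q.Fiber (i z)) :=
  (LinearMap.range (diff 𝕜 𝕂 E E' i z)).comap (Q.anchor (i z))

variable {Q : CourantOps 𝕜 𝕂 E X}

theorem exists_fibProd {v : Q.Fiber (i z)} (hv : v ∈ Q.tangentSub E' i z) :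
    ∃ u : Q.fibProd E' i z, u.1.2 = v := by
  obtain ⟨ξ, hξ⟩ := hv
  exact ⟨⟨(ξ, v), hξ⟩, rfl⟩

theorem snd_mem_tangentSub (u : Q.fibProd E' i z) : u.1.2 ∈ Q.tangentSub E' i z :=
  ⟨u.1.1, u.2⟩

/-- A functional on covectors that vanishes on the kernel of the surjection `(di)^∨` factors through
it. As `Tan` is defined as a dual, the factor is the required tangent vector to `Z`. -/
theorem mem_tangentSub_iff (hs : Function.Surjective (codiff 𝕜 𝕂 E E' i z))
    {v : Q.Fiber (i z)} : v ∈ Q.tangentSub E' i z ↔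
      ∀ α ∈ conormal 𝕜 𝕂 E E' i z, Q.anchor (i z) v α = 0 := by
  constructor
  · rintro ⟨ξ, hξ⟩ α hα
    rw [← hξ]
    change ξ (codiff 𝕜 𝕂 E E' i z α) = 0
    rw [show codiff 𝕜 𝕂 E E' i z α = 0 from hα, map_zero]
  · intro h
    obtain ⟨g, hg⟩ := (codiff 𝕜 𝕂 E E' i z).exists_rightInverse_of_surjective
      (LinearMap.range_eq_top.2 hs)
    let a : Cot 𝕜 𝕂 E (i z) →ₗ[𝕂] 𝕂 := Q.anchor (i z) v
    refine ⟨a ∘ₗ g, LinearMap.ext (M := Cot 𝕜 𝕂 E (i z)) (M₃ := 𝕂) fun α => ?_⟩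
    change a (g (codiff 𝕜 𝕂 E E' i z α)) = a α
    rw [← sub_eq_zero, ← map_sub]
    refine h _ ?_
    change codiff 𝕜 𝕂 E E' i z _ = 0
    rw [map_sub, sub_eq_zero]
    exact LinearMap.congr_fun hg _

theorem diff_injective (hs : Function.Surjective (codiff 𝕜 𝕂 E E' i z)) :
    Function.Injective (diff 𝕜 𝕂 E E' i z) := by
  intro ξ η h
  refine LinearMap.ext (M := Cot 𝕜 𝕂 E' z) (M₃ := 𝕂) fun β => ?_
  obtain ⟨α, rfl⟩ := hs β
  exact LinearMap.congr_fun (M := Cot 𝕜 𝕂 E (i z)) (M₃ := 𝕂) h α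

theorem snd_injective (hs : Function.Surjective (codiff 𝕜 𝕂 E E' i z)) :
    Function.Injective (LinearMap.snd 𝕂 _ _ ∘ₗ (Q.fibProd E' i z).subtype) := by
  intro u v h
  have h2 : u.1.2 = v.1.2 := h
  have hu : diff 𝕜 𝕂 E E' i z u.1.1 = Q.anchor (i z) u.1.2 := u.2
  have hv : diff 𝕜 𝕂 E E' i z v.1.1 = Q.anchor (i z) v.1.2 := v.2
  exact Subtype.ext (Prod.ext (diff_injective hs (by rw [hu, hv, h2])) h2)

theorem finrank_fibProd (hs : Function.Surjective (codiff 𝕜 𝕂 E E' i z)) :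
    finrank 𝕂 (Q.fibProd E' i z) = finrank 𝕂 (Q.tangentSub E' i z) := by
  have h : LinearMap.range (LinearMap.snd 𝕂 _ _ ∘ₗ (Q.fibProd E' i z).subtype) =
      Q.tangentSub E' i z := by
    ext v
    constructor
    · rintro ⟨u, rfl⟩
      exact snd_mem_tangentSub u
    · intro hv
      obtain ⟨u, rfl⟩ := exists_fibProd hv
      exact ⟨u, rfl⟩
  rw [← LinearMap.finrank_range_of_inj (snd_injective hs), h]

variable (hQ : Q.IsCourant n)
include hQ

theorem conormalImage_le_tangentSub (z : Z) : Q.conormalImage E' i z ≤ Q.tangentSub E' i z := by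
  rintro _ ⟨α, -, rfl⟩
  refine ⟨0, ?_⟩
  rw [hQ.anchor_coanchor, map_zero]

theorem pairing_eq_zero_of_conormalImage (hs : Function.Surjective (codiff 𝕜 𝕂 E E' i z))
    {v w : Q.Fiber (i z)} (hv : v ∈ Q.tangentSub E' i z) (hw : w ∈ Q.conormalImage E' i z) :
    Q.pairing (i z) v w = 0 := by
  obtain ⟨α, hα, rfl⟩ := hw
  rw [hQ.pairing_coanchor]
  exact (mem_tangentSub_iff hs).1 hv α hα

theorem isFun_anchor_dif (hi : Manifold.IsImmersion 𝓘(𝕜, E') 𝓘(𝕜, E) n i)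
    {σ : ∀ w, Q.Fiber (i w)} (hσ : (Q.toModFamily.pullback 𝕜 n E' i).IsSec σ z)
    {f : X → 𝕂} (hf : IsFun 𝕜 E n f (i z)) :
    IsFun 𝕜 E' n (fun w => Q.anchor (i w) (σ w) (dif 𝕜 E f (i w))) z := by
  obtain ⟨q, hq, hqσ⟩ := hQ.locallyFree.exists_extension hi hσ
  refine (((hQ.isVec_anchor _ q hq).self_of_nhds f hf).comp hi.contMDiff).congr ?_
  filter_upwards [hqσ] with w hw
  rw [hw]
  rfl

/-- By `mem_tangentSub_iff` this is the common kernel of the forms `v ↦ π(v)(df_k)`, where the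
`df_k` generate the conormal bundle. -/
theorem isRegularAt_tangentSub [FiniteDimensional 𝕜 E] (hn : n ≠ 0)
    (hi : Manifold.IsImmersion 𝓘(𝕜, E') 𝓘(𝕜, E) n i)
    (hs : ∀ z, Function.Surjective (codiff 𝕜 𝕂 E E' i z))
    (hfib : IsLocallyConstant fun z => finrank 𝕂 (Q.fibProd E' i z)) (z : Z) :
    (Q.toModFamily.pullback 𝕜 n E' i).IsRegularAt (Q.tangentSub E' i) z := by
  obtain ⟨m, f, hf, hf0, hspan⟩ := exists_conormal_generators (𝕂 := 𝕂) hn hi z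
  let φ : Fin m → ∀ w, Q.Fiber (i w) →ₗ[𝕂] 𝕂 := fun k w =>
    { toFun := fun v => Q.anchor (i w) v (dif 𝕜 E (f k) (i w))
      map_add' := fun u v => by rw [map_add]; rfl
      map_smul' := fun c v => by rw [map_smul]; rfl }
  refine (hQ.locallyFree.pullback hi.contMDiff).isRegularAt_ker (φ := φ)
    (fun k σ hσ => isFun_anchor_dif hQ hi hσ (hf k)) ?_ ?_
  · filter_upwards [hspan] with w hw v
    refine (mem_tangentSub_iff (hs w)).trans ?_
    rw [hw]
    constructor
    · exact fun h k => h _ (Submodule.subset_span ⟨k, rfl⟩)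
    · intro h α hα
      induction hα using Submodule.span_induction with
      | mem α hα => obtain ⟨k, rfl⟩ := hα; exact h k
      | zero => exact map_zero _
      | add α β _ _ h1 h2 => rw [map_add, h1, h2, add_zero]
      | smul c α _ h1 => rw [map_smul, h1, smul_zero]
  · filter_upwards [hfib.eventually_eq z] with w hw
    exact (finrank_fibProd (hs w)).symm.trans (hw.trans (finrank_fibProd (hs z)))

theorem exists_conormalImage_generators [FiniteDimensional 𝕜 E] (hn : n ≠ 0)
    (hi : Manifold.IsImmersion 𝓘(𝕜, E') 𝓘(𝕜, E) n i) (z : Z) :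
    ∃ (m : ℕ) (f : Fin m → X → 𝕂), (∀ j, IsFun 𝕜 E n (f j) (i z)) ∧
      (∀ j, ∀ᶠ w in 𝓝 z, f j (i w) = 0) ∧
      (∀ j, Q.IsSec (fun y => Q.coanchor y (dif 𝕜 E (f j) y)) (i z)) ∧
      ∀ᶠ w in 𝓝 z, Q.conormalImage E' i w =
        Submodule.span 𝕂 (Set.range fun j => Q.coanchor (i w) (dif 𝕜 E (f j) (i w))) := by
  obtain ⟨m, f, hf, hf0, hspan⟩ := exists_conormal_generators (𝕂 := 𝕂) hn hi z
  refine ⟨m, f, hf, hf0, fun j => hQ.isSec_coanchor _ _ ⟨1, fun _ _ => 1, fun _ => f j,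
    fun _ => isFun_const 1 _, fun _ => hf j, Eventually.of_forall fun y => by simp⟩, ?_⟩
  filter_upwards [hspan] with w hw
  rw [conormalImage, hw, Submodule.map_span, ← Set.range_comp]
  rfl

theorem isRegularAt_conormalImage [FiniteDimensional 𝕜 E] (hn : n ≠ 0)
    (hi : Manifold.IsImmersion 𝓘(𝕜, E') 𝓘(𝕜, E) n i)
    (hcon : IsLocallyConstant fun z => finrank 𝕂 (Q.conormalImage E' i z)) (z : Z) :
    (Q.toModFamily.pullback 𝕜 n E' i).IsRegularAt (Q.conormalImage E' i) z := by
  obtain ⟨m, f, hf, hf0, hsec, hspan⟩ := exists_conormalImage_generators hQ hn hi z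
  exact (hQ.locallyFree.pullback hi.contMDiff).isRegularAt_span
    (τ := fun j w => Q.coanchor (i w) (dif 𝕜 E (f j) (i w)))
    (fun j => ModFamily.isSec_pullback_comp (hsec j)) hspan (hcon.eventually_eq z)

/-! ### The bracket and the sub-bundles -/

/-- Sections with anchor tangent to `Z` are closed under the bracket. -/
theorem bracket_mem_tangentSub [FiniteDimensional 𝕜 E] (hn : n ≠ 0)
    (hi : Manifold.IsImmersion 𝓘(𝕜, E') 𝓘(𝕜, E) n i)
    (hs : ∀ z, Function.Surjective (codiff 𝕜 𝕂 E E' i z)) {q p : ∀ x, Q.Fiber x}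
    (hq : Q.IsSec q (i z)) (hp : Q.IsSec p (i z))
    (hqT : ∀ᶠ w in 𝓝 z, q (i w) ∈ Q.tangentSub E' i w)
    (hpT : ∀ᶠ w in 𝓝 z, p (i w) ∈ Q.tangentSub E' i w) :
    Q.bracket q p (i z) ∈ Q.tangentSub E' i z := by
  obtain ⟨m, f, hf, hf0, hspan⟩ := exists_conormal_generators (𝕂 := 𝕂) hn hi z
  -- A vector field tangent to `Z` maps functions vanishing on `Z` to functions vanishing on `Z`;
  -- hence so does the commutator of two of them.
  have key : ∀ {s : ∀ x, Q.Fiber x} {g : X → 𝕂}, (∀ᶠ w in 𝓝 z, s (i w) ∈ Q.tangentSub E' i w) →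
      IsFun 𝕜 E n g (i z) → (∀ᶠ w in 𝓝 z, g (i w) = 0) →
      ∀ᶠ w in 𝓝 z, der 𝕜 E (fun y => Q.anchor y (s y)) g (i w) = 0 := by
    intro s g hs' hg hg0
    filter_upwards [hs', hi.contMDiff.continuous.continuousAt.eventually hg.eventually,
      eventually_eventually_nhds.2 hg0] with w h1 h2 h3
    exact (mem_tangentSub_iff (hs w)).1 h1 _ (dif_mem_conormal hn hi.contMDiff h2 h3)
  rw [mem_tangentSub_iff (hs z), hspan.self_of_nhds]
  intro α hα
  induction hα using Submodule.span_induction with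
  | mem α hα =>
    obtain ⟨k, rfl⟩ := hα
    refine (hQ.anchor_bracket _ q p hq hp (f k) (hf k)).trans ?_
    have h1 := key hqT ((hQ.isVec_anchor _ p hp).self_of_nhds _ (hf k)) (key hpT (hf k) (hf0 k))
    have h2 := key hpT ((hQ.isVec_anchor _ q hq).self_of_nhds _ (hf k)) (key hqT (hf k) (hf0 k))
    rw [h1.self_of_nhds, h2.self_of_nhds, sub_zero]
  | zero => exact map_zero _
  | add α β _ _ h1 h2 => rw [map_add, h1, h2, add_zero]
  | smul c α _ h1 => rw [map_smul, h1, smul_zero]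

theorem bracket_sum_right {x : X} {q : ∀ x, Q.Fiber x} (hq : Q.IsSec q x) {ι : Type*}
    (J : Finset ι) {p : ι → ∀ x, Q.Fiber x} (hp : ∀ j, Q.IsSec (p j) x) :
    Q.bracket q (fun y => ∑ j ∈ J, p j y) x = ∑ j ∈ J, Q.bracket q (p j) x := by
  classical
  have hsum : ∀ J : Finset ι, Q.IsSec (fun y => ∑ j ∈ J, p j y) x := fun J => by
    simpa using hQ.locallyFree.isSec_sum (c := fun _ _ => 1) (J := J)
      (fun _ _ => isFun_const 1 x) (fun j _ => hp j)
  induction J using Finset.induction_on with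
  | empty =>
    -- The empty sum is `0 • q`; any section could replace `q` here.
    have h := hQ.bracket_const_right x 0 q q hq hq
    simpa using h
  | insert a J ha ih =>
    simp only [Finset.sum_insert ha]
    rw [hQ.bracket_add_right x q _ _ hq (hp a) (hsum J), ih]

/-- The bracket of a section with tangent anchor with a section vanishing on `Z`. -/
theorem bracket_eq_zero_of_vanishing (hn : n ≠ 0)
    (hi : ContMDiff 𝓘(𝕜, E') 𝓘(𝕜, E) n i)
    (hs : ∀ z, Function.Surjective (codiff 𝕜 𝕂 E E' i z)) {q h : ∀ x, Q.Fiber x}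
    (hq : Q.IsSec q (i z)) (hh : Q.IsSec h (i z)) (hqT : q (i z) ∈ Q.tangentSub E' i z)
    (hh0 : ∀ᶠ w in 𝓝 z, h (i w) = 0) : Q.bracket q h (i z) = 0 := by
  obtain ⟨U, hU, hzU, r, e, he⟩ := hQ.locallyFree (i z)
  obtain ⟨c, hc, hhc⟩ := (he.2 _ hzU h).1 hh
  -- In a frame, vanishing on `Z` passes to the coefficients. The Leibniz rule then leaves `c_j {q,
  -- e_j}`, zero at `z`, and `π(q)(c_j) e_j`, zero by tangency.
  have hc0 : ∀ j, ∀ᶠ w in 𝓝 z, c j (i w) = 0 := by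
    intro j
    filter_upwards [hh0, hi.continuous.continuousAt.eventually (hU.mem_nhds hzU),
      hi.continuous.continuousAt.eventually hhc] with w h1 h2 h3
    rw [h1] at h3
    exact Fintype.linearIndependent_iff.1 (he.1 _ h2).1 _ h3.symm j
  have hce : ∀ j, Q.IsSec (fun y => c j y • e j y) (i z) := fun j =>
    hQ.locallyFree.isSec_smul (hc j) (he.isSec hzU j)
  rw [hQ.bracket_congr _ q q h (fun y => ∑ j, c j y • e j y) hq hq hh (he.isSec_sum hzU hc)
    (Eventually.of_forall fun _ => rfl) hhc, bracket_sum_right hQ hq Finset.univ hce]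
  refine Finset.sum_eq_zero fun j _ => ?_
  rw [hQ.bracket_smul_right _ (c j) q (e j) (hc j) hq (he.isSec hzU j), (hc0 j).self_of_nhds,
    zero_smul, zero_add]
  have h1 : der 𝕜 E (fun y => Q.anchor y (q y)) (c j) (i z) = 0 :=
    (mem_tangentSub_iff (hs z)).1 hqT _ (dif_mem_conormal hn hi (hc j) (hc0 j))
  rw [h1, zero_smul]

variable [FiniteDimensional 𝕜 E] (hn : n ≠ 0)
  (hi : Manifold.IsImmersion 𝓘(𝕜, E') 𝓘(𝕜, E) n i)
  (hs : ∀ z, Function.Surjective (codiff 𝕜 𝕂 E E' i z))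
  (hcon : IsLocallyConstant fun z => finrank 𝕂 (Q.conormalImage E' i z))
include hn hi hs hcon

/-- On `Z` the section `c` agrees with some `π^†α`, `α = ∑ g_j df_j`, where the `f_j` vanish on `Z`;
constant rank makes the coefficients functions. The difference vanishes on `Z` and does not
contribute, while `{q, π^†α} = π^†(L_ξ α)` with `ξ = π(q)`. The terms `ξ(g_j) df_j` and `g_j
d(ξ(f_j))` are conormal, since `ξ(f_j)` vanishes on `Z` as well. -/
theorem bracket_mem_conormalImage_right {q c : ∀ x, Q.Fiber x}
    (hq : Q.IsSec q (i z)) (hc : Q.IsSec c (i z))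
    (hqT : ∀ᶠ w in 𝓝 z, q (i w) ∈ Q.tangentSub E' i w)
    (hcC : ∀ᶠ w in 𝓝 z, c (i w) ∈ Q.conormalImage E' i w) :
    Q.bracket q c (i z) ∈ Q.conormalImage E' i z := by
  obtain ⟨m, f, hf, hf0, hsec, hspan⟩ := exists_conormalImage_generators hQ hn hi z
  obtain ⟨g₀, hg₀, hcg⟩ := (hQ.locallyFree.pullback hi.contMDiff).exists_coeff_of_mem_span
    (τ := fun j w => Q.coanchor (i w) (dif 𝕜 E (f j) (i w)))
    (fun j => ModFamily.isSec_pullback_comp (hsec j)) hspan (hcon.eventually_eq z)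
    (ModFamily.isSec_pullback_comp hc) hcC
  choose g hg hgg₀ using fun j => exists_isFun_extension hi (hg₀ j)
  let α : ∀ x, Cot 𝕜 𝕂 E x := fun y => ∑ j, g j y • dif 𝕜 E (f j) y
  let ξ : ∀ x, Tan 𝕜 𝕂 E x := fun y => Q.anchor y (q y)
  let β : ∀ x, Cot 𝕜 𝕂 E x := fun y => ∑ j, (der 𝕜 E ξ (g j) y • dif 𝕜 E (f j) y +
    g j y • dif 𝕜 E (der 𝕜 E ξ (f j)) y)
  have hα : Q.IsSec (fun y => Q.coanchor y (α y)) (i z) :=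
    hQ.isSec_coanchor _ _ ⟨m, g, f, hg, hf, Eventually.of_forall fun _ => rfl⟩
  have hh : Q.IsSec (fun y => c y - Q.coanchor y (α y)) (i z) := hQ.locallyFree.isSec_sub hc hα
  have hh0 : ∀ᶠ w in 𝓝 z, c (i w) - Q.coanchor (i w) (α (i w)) = 0 := by
    filter_upwards [hcg, eventually_all.2 hgg₀] with w h1 h2
    refine sub_eq_zero.2 (h1.trans ?_)
    simp only [α, map_sum, map_smul, h2]
    rfl
  have hsplit : Q.bracket q c (i z) = Q.coanchor (i z) (β (i z)) := by
    have h1 := hQ.bracket_add_right (i z) q _ _ hq hh hα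
    simp only [sub_add_cancel] at h1
    rw [h1, bracket_eq_zero_of_vanishing hQ hn hi.contMDiff hs hq hh hqT.self_of_nhds hh0, zero_add]
    exact hQ.bracket_coanchor _ q α β hq ⟨m, g, f, hg, hf, Eventually.of_forall fun _ => rfl,
      Eventually.of_forall fun _ => rfl⟩
  rw [hsplit]
  refine ⟨_, ?_, rfl⟩
  refine Submodule.sum_mem _ fun j _ => Submodule.add_mem _ (Submodule.smul_mem _ _ ?_)
    (Submodule.smul_mem _ _ ?_)
  · exact dif_mem_conormal hn hi.contMDiff (hf j) (hf0 j)
  · refine dif_mem_conormal hn hi.contMDiff ((hQ.isVec_anchor _ q hq).self_of_nhds _ (hf j)) ?_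
    filter_upwards [hqT, hi.contMDiff.continuous.continuousAt.eventually (hf j).eventually,
      eventually_eventually_nhds.2 (hf0 j)] with w h1 h2 h3
    exact (mem_tangentSub_iff (hs w)).1 h1 _ (dif_mem_conormal hn hi.contMDiff h2 h3)

/-- The symmetric part of the bracket is `π^† d⟨q, c⟩`, and `⟨q, c⟩` vanishes on `Z` by
orthogonality, so its differential is conormal. This reduces to the other side. -/
theorem bracket_mem_conormalImage_left {q c : ∀ x, Q.Fiber x}
    (hq : Q.IsSec q (i z)) (hc : Q.IsSec c (i z))
    (hqT : ∀ᶠ w in 𝓝 z, q (i w) ∈ Q.tangentSub E' i w)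
    (hcC : ∀ᶠ w in 𝓝 z, c (i w) ∈ Q.conormalImage E' i w) :
    Q.bracket c q (i z) ∈ Q.conormalImage E' i z := by
  have h1 := hQ.bracket_add_bracket _ q c hq hc
  have h2 : Q.bracket c q (i z) = Q.coanchor (i z)
      (dif 𝕜 E (fun y => Q.pairing y (q y) (c y)) (i z)) - Q.bracket q c (i z) := by
    rw [← h1, add_sub_cancel_left]
  rw [h2]
  refine Submodule.sub_mem _ ⟨_, dif_mem_conormal hn hi.contMDiff
    (hQ.isFun_pairing _ q c hq hc) ?_, rfl⟩
    (bracket_mem_conormalImage_right hQ hn hi hs hcon hq hc hqT hcC)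
  filter_upwards [hqT, hcC] with w h3 h4
  exact pairing_eq_zero_of_conormalImage hQ (hs w) h3 h4

/-- The class of `{q, p}` modulo `π^†(N^∨_{Z|X})` depends only on the classes of `q` and `p`. -/
theorem bracket_sub_bracket_mem {q q' p p' : ∀ x, Q.Fiber x} (hq : Q.IsSec q (i z))
    (hq' : Q.IsSec q' (i z)) (hp : Q.IsSec p (i z)) (hp' : Q.IsSec p' (i z))
    (hqT : ∀ᶠ w in 𝓝 z, q (i w) ∈ Q.tangentSub E' i w)
    (hpT : ∀ᶠ w in 𝓝 z, p (i w) ∈ Q.tangentSub E' i w)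
    (hqq' : ∀ᶠ w in 𝓝 z, q' (i w) - q (i w) ∈ Q.conormalImage E' i w)
    (hpp' : ∀ᶠ w in 𝓝 z, p' (i w) - p (i w) ∈ Q.conormalImage E' i w) :
    Q.bracket q' p' (i z) - Q.bracket q p (i z) ∈ Q.conormalImage E' i z := by
  have hc := hQ.locallyFree.isSec_sub hq' hq
  have hd := hQ.locallyFree.isSec_sub hp' hp
  have h1 := hQ.bracket_add_left (i z) _ _ p' hc hq hp'
  have h2 := hQ.bracket_add_right (i z) q _ _ hq hd hp
  simp only [sub_add_cancel] at h1 h2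
  have hp'T : ∀ᶠ w in 𝓝 z, p' (i w) ∈ Q.tangentSub E' i w := by
    filter_upwards [hpT, hpp'] with w h3 h4
    simpa using Submodule.add_mem _ (conormalImage_le_tangentSub hQ w h4) h3
  -- `{q', p'} - {q, p} = {q' - q, p'} + {q, p' - p}`.
  rw [h1, h2, ← add_assoc, add_sub_cancel_right]
  exact Submodule.add_mem _
    (bracket_mem_conormalImage_left hQ hn hi hs hcon hp' hc hp'T hqq')
    (bracket_mem_conormalImage_right hQ hn hi hs hcon hq hd hqT hpp')

end CourantOps

end

namespace CourantOps

variable {𝕜 : Type*} [RCLike 𝕜] {𝕂 : Type*} [RCLike 𝕂] [NormedAlgebra 𝕜 𝕂] {n : WithTop ℕ∞}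
  {E : Type*} [NormedAddCommGroup E] [NormedSpace 𝕜 E]
  {X : Type*} [TopologicalSpace X] [ChartedSpace E X]
  {E' : Type*} [NormedAddCommGroup E'] [NormedSpace 𝕜 E']
  {Z : Type*} [TopologicalSpace Z] [ChartedSpace E' Z] {i : Z → X} {z : Z}

/-! ### The inverse image as a subquotient -/

section PullMap

variable {Q : CourantOps 𝕜 𝕂 E X}

/-- A linear map on the fibre of `i^*Q` which sends `v` to the class of `(ξ, v)` in `i^{++}Q`,
for every `(ξ, v)` in `𝒯_Z ×_{i^*𝒯_X} i^*Q`. -/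
def IsPullMap (Q : CourantOps 𝕜 𝕂 E X) (i : Z → X) (z : Z)
    (F : Q.Fiber (i z) →ₗ[𝕂] Q.PullFiber E' i z) : Prop :=
  ∀ u : Q.fibProd E' i z, F u.1.2 = Q.pullMk E' i z u

/-- The second projection embeds the fibre product into the fibre of `i^*Q`. A left inverse gives a
map on the whole fibre, whose values off `tangentSub` are arbitrary and never matter. -/
theorem exists_isPullMap (hs : Function.Surjective (codiff 𝕜 𝕂 E E' i z)) :
    ∃ F : Q.Fiber (i z) →ₗ[𝕂] Q.PullFiber E' i z, Q.IsPullMap i z F := by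
  obtain ⟨g, hg⟩ := LinearMap.exists_leftInverse_of_injective
    (LinearMap.snd 𝕂 _ _ ∘ₗ (Q.fibProd E' i z).subtype) (LinearMap.ker_eq_bot.2 (snd_injective hs))
  exact ⟨Q.pullMk E' i z ∘ₗ g, fun u => congrArg _ (LinearMap.congr_fun hg u)⟩

variable {F : Q.Fiber (i z) →ₗ[𝕂] Q.PullFiber E' i z} (hF : Q.IsPullMap i z F)
include hF

theorem IsPullMap.map_eq_zero_iff {v : Q.Fiber (i z)} (hv : v ∈ Q.tangentSub E' i z)
    (hinj : Function.Injective (diff 𝕜 𝕂 E E' i z))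
    (hanchor : ∀ w ∈ Q.conormalImage E' i z, Q.anchor (i z) w = 0) :
    F v = 0 ↔ v ∈ Q.conormalImage E' i z := by
  obtain ⟨u, rfl⟩ := exists_fibProd hv
  rw [hF u, Submodule.mkQ_apply, Submodule.Quotient.mk_eq_zero]
  constructor
  · rintro ⟨w, hw, hwu⟩
    rwa [← show w = u.1.2 from congrArg Prod.snd hwu]
  · intro h
    refine ⟨u.1.2, h, Prod.ext ?_ rfl⟩
    have hu : diff 𝕜 𝕂 E E' i z u.1.1 = Q.anchor (i z) u.1.2 := u.2
    rw [hanchor _ h, ← map_zero (diff 𝕜 𝕂 E E' i z)] at hu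
    exact (hinj hu).symm

theorem IsPullMap.exists_eq (t : Q.PullFiber E' i z) : ∃ v ∈ Q.tangentSub E' i z, F v = t := by
  obtain ⟨u, rfl⟩ := Submodule.mkQ_surjective _ t
  exact ⟨u.1.2, snd_mem_tangentSub u, hF u⟩

end PullMap

theorem pullSub_eq_map {Q : CourantOps 𝕜 𝕂 E X}
    {F : ∀ z, Q.Fiber (i z) →ₗ[𝕂] Q.PullFiber E' i z}
    (hF : ∀ z, Q.IsPullMap i z (F z)) {K : ∀ z, Submodule 𝕂 (Q.Fiber (i z))}
    (hK : K z ≤ Q.tangentSub E' i z) : Q.pullSub E' i K z = (K z).map (F z) := by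
  ext t
  constructor
  · rintro ⟨u, hu, rfl⟩
    exact ⟨u.1.2, hu, hF z u⟩
  · rintro ⟨v, hv, rfl⟩
    obtain ⟨u, rfl⟩ := exists_fibProd (hK hv)
    exact ⟨u, hv, (hF z u).symm⟩

theorem lifts_iff {Q : CourantOps 𝕜 𝕂 E X}
    {F : ∀ z, Q.Fiber (i z) →ₗ[𝕂] Q.PullFiber E' i z} (hF : ∀ z, Q.IsPullMap i z (F z))
    {s : ∀ z, Q.PullFiber E' i z} {q : ∀ x, Q.Fiber x} :
    Q.Lifts E' i s z q ↔ Q.IsSec q (i z) ∧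
      ∀ᶠ w in 𝓝 z, q (i w) ∈ Q.tangentSub E' i w ∧ s w = F w (q (i w)) := by
  refine and_congr_right fun _ => eventually_congr (Eventually.of_forall fun w => ⟨?_, ?_⟩)
  · rintro ⟨u, hu, hsu⟩
    rw [← hu, hF]
    exact ⟨snd_mem_tangentSub u, hsu⟩
  · rintro ⟨hq, hs⟩
    obtain ⟨u, hu⟩ := exists_fibProd hq
    exact ⟨u, hu, by rw [hs, ← hu, hF]⟩

theorem pullSub_tangentSub_inf_comap {Q : CourantOps 𝕜 𝕂 E X}
    {F : ∀ z, Q.Fiber (i z) →ₗ[𝕂] Q.PullFiber E' i z} (hF : ∀ z, Q.IsPullMap i z (F z))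
    (D : ∀ z, Submodule 𝕂 (Q.PullFiber E' i z)) :
    Q.pullSub E' i (fun z => Q.tangentSub E' i z ⊓ (D z).comap (F z)) = D := by
  funext z
  rw [pullSub_eq_map hF inf_le_left]
  refine le_antisymm (Submodule.map_le_iff_le_comap.2 inf_le_right) fun t ht => ?_
  obtain ⟨v, hv, rfl⟩ := (hF z).exists_eq t
  exact ⟨v, ⟨hv, ht⟩, rfl⟩

theorem IsAlmostDirac.le_tangentSub {Q : CourantOps 𝕜 𝕂 E X}
    {K : ∀ z, Submodule 𝕂 (Q.Fiber (i z))}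
    (hK : Q.IsAlmostDirac n E' i K) (z : Z) : K z ≤ Q.tangentSub E' i z :=
  fun v hv => hK.anchor_mem z v hv

/-! ### Locality of the bracket condition -/

/-- A condition on the germ at `z` must become one on an open set of `X`. This is where `Z` has to
carry the induced topology: a neighbourhood of `z` contains the trace of an open set of `X`, which
can be shrunk until both germs are sections on it. -/
theorem isDirac_iff_local {Q : CourantOps 𝕜 𝕂 E X}
    (hloc : ∀ x s, Q.IsSec s x → ∀ᶠ y in 𝓝 x, Q.IsSec s y) (hi : IsEmbedding i)
    {K : ∀ z, Submodule 𝕂 (Q.Fiber (i z))} :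
    Q.IsDirac n E' i K ↔ Q.IsAlmostDirac n E' i K ∧ ∀ z q p, Q.IsSec q (i z) → Q.IsSec p (i z) →
      (∀ᶠ w in 𝓝 z, q (i w) ∈ K w) → (∀ᶠ w in 𝓝 z, p (i w) ∈ K w) →
      Q.bracket q p (i z) ∈ K z := by
  refine ⟨fun h => ⟨h.toIsAlmostDirac, fun z q p hq hp hqK hpK => ?_⟩, fun ⟨h, h'⟩ => ⟨h, ?_⟩⟩
  · have h1 := hqK.and hpK
    rw [hi.isInducing.nhds_eq_comap, eventually_comap] at h1
    obtain ⟨U, hU, hUo, hzU⟩ := eventually_nhds_iff.1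
      (h1.and ((hloc _ q hq).and (hloc _ p hp)))
    exact h.bracket_mem U hUo q p (fun x hx => (hU x hx).2.1) (fun x hx => (hU x hx).2.2)
      (fun w hw => ((hU _ hw).1 w rfl).1) (fun w hw => ((hU _ hw).1 w rfl).2) z hzU
  · intro U hU q p hq hp hqK hpK z hz
    have hev : ∀ᶠ w in 𝓝 z, i w ∈ U := hi.continuous.continuousAt.eventually (hU.mem_nhds hz)
    exact h' z q p (hq _ hz) (hp _ hz) (hev.mono fun w hw => hqK w hw)
      (hev.mono fun w hw => hpK w hw)

/-! ### Comparison of Dirac structures -/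

section Pull

variable [FiniteDimensional 𝕜 E] [IsManifold 𝓘(𝕜, E) n X] [IsManifold 𝓘(𝕜, E') n Z]
  (hn : ∞ ≤ n) (hi : Manifold.IsSmoothEmbedding 𝓘(𝕜, E') 𝓘(𝕜, E) n i)
  {Q : CourantOps 𝕜 𝕂 E X} (hQ : Q.IsCourant n)
  {F : ∀ z, Q.Fiber (i z) →ₗ[𝕂] Q.PullFiber E' i z} (hF : ∀ z, Q.IsPullMap i z (F z))

include hn hi in
theorem codiff_surjective_of_isSmoothEmbedding (z : Z) : Function.Surjective (codiff 𝕜 𝕂 E E' i z) :=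
  codiff_surjective 𝕜 n hn hi.isImmersion z

include hn in
theorem order_ne_zero : n ≠ 0 := fun h => by simp [h] at hn

include hn hi hQ hF in
theorem pullMap_eq_zero_iff {v : Q.Fiber (i z)} (hv : v ∈ Q.tangentSub E' i z) :
    F z v = 0 ↔ v ∈ Q.conormalImage E' i z := by
  refine (hF z).map_eq_zero_iff hv (diff_injective (codiff_surjective_of_isSmoothEmbedding hn hi z)) ?_
  rintro _ ⟨α, -, rfl⟩
  exact hQ.anchor_coanchor _ α

include hF in
-- The vector field `ξ` is determined by `σ` and is automatically a section of `𝒯_Z`: if `G` extends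
-- `f` to `X`, then `ξ(f)` is the function `π(σ)(dG)`.
theorem isSec_pull_iff {s : ∀ z, Q.PullFiber E' i z} : (Q.pull hn hi hQ).IsSec s z ↔
    ∃ σ, (Q.toModFamily.pullback 𝕜 n E' i).IsSec σ z ∧
      ∀ᶠ w in 𝓝 z, σ w ∈ Q.tangentSub E' i w ∧ s w = F w (σ w) := by
  constructor
  · rintro ⟨ξ, σ, -, hσ, h⟩
    refine ⟨σ, hσ, ?_⟩
    filter_upwards [h] with w ⟨hw, hsw⟩
    exact ⟨snd_mem_tangentSub ⟨_, hw⟩, hsw.trans (hF w ⟨_, hw⟩).symm⟩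
  · rintro ⟨σ, hσ, h⟩
    have hex : ∀ w, ∃ ξ : Tan 𝕜 𝕂 E' w, σ w ∈ Q.tangentSub E' i w →
        diff 𝕜 𝕂 E E' i w ξ = Q.anchor (i w) (σ w) := by
      intro w
      by_cases hw : σ w ∈ Q.tangentSub E' i w
      · obtain ⟨ξ, hξ⟩ := hw
        exact ⟨ξ, fun _ => hξ⟩
      · exact ⟨0, fun h => absurd h hw⟩
    choose ξ hξ using hex
    refine ⟨ξ, σ, ?_, hσ, ?_⟩
    · filter_upwards [eventually_eventually_nhds.2 h,
        (hQ.locallyFree.pullback hi.contMDiff).isSec_eventually hσ] with y hy hσy f hf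
      obtain ⟨G, hG, hGf⟩ := exists_isFun_extension hi.isImmersion hf
      refine (isFun_anchor_dif hQ hi.isImmersion hσy hG).congr ?_
      filter_upwards [hy, hi.contMDiff.continuous.continuousAt.eventually hG.eventually,
        eventually_eventually_nhds.2 hGf] with w h1 h2 h3
      rw [← hξ w h1.1]
      change ξ w _ = ξ w (codiff 𝕜 𝕂 E E' i w _)
      rw [codiff_dif (order_ne_zero hn) hi.contMDiff h2, dif_congr h3]
    · filter_upwards [h] with w hw
      exact ⟨hξ w hw.1, hw.2.trans (hF w ⟨(ξ w, σ w), hξ w hw.1⟩)⟩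

include hF in
-- The pull-back along `id` occurs because Dirac structures in `i^{++}Q` are Dirac structures
-- supported on `id`.
theorem isSubquotient_pull : ModFamily.IsSubquotient (Q.toModFamily.pullback 𝕜 n E' i)
    ((Q.pull hn hi hQ).toModFamily.pullback 𝕜 n E' id) (Q.tangentSub E' i)
    (Q.conormalImage E' i) F where
  le := conormalImage_le_tangentSub hQ
  map_eq_top z := by
    refine eq_top_iff.2 fun t _ => ?_
    obtain ⟨v, hv, hvt⟩ := (hF z).exists_eq t
    exact ⟨v, hv, hvt⟩
  map_eq_zero_iff z v hv := pullMap_eq_zero_iff hn hi hQ hF hv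
  isSec_iff z s := by
    constructor
    · rintro ⟨r, c, q, hc, hq, hs⟩
      choose σ hσ hσq using fun j => (isSec_pull_iff hn hi hQ hF).1 (hq j)
      refine ⟨fun w => ∑ j, c j w • σ j w,
        (hQ.locallyFree.pullback hi.contMDiff).isSec_sum (fun j _ => hc j) fun j _ => hσ j, ?_⟩
      filter_upwards [hs, eventually_all.2 hσq] with w h1 h2
      refine ⟨Submodule.sum_mem _ fun j _ => Submodule.smul_mem _ _ (h2 j).1, ?_⟩
      refine h1.trans (Eq.symm ?_)
      refine (map_sum (F w) _ _).trans (Finset.sum_congr rfl fun j _ => ?_)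
      exact ((F w).map_smul _ _).trans (congrArg (c j w • ·) (h2 j).2.symm)
    · rintro ⟨σ, hσ, hs⟩
      exact ModFamily.isSec_pullback_comp (i := id) (S := (Q.pull hn hi hQ).toModFamily)
        ((isSec_pull_iff hn hi hQ hF).2 ⟨σ, hσ, hs⟩)

include hF in
theorem isSec_pull_eventually {s : ∀ z, Q.PullFiber E' i z} (hs : (Q.pull hn hi hQ).IsSec s z) :
    ∀ᶠ w in 𝓝 z, (Q.pull hn hi hQ).IsSec s w := by
  obtain ⟨σ, hσ, h⟩ := (isSec_pull_iff hn hi hQ hF).1 hs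
  filter_upwards [(hQ.locallyFree.pullback hi.contMDiff).isSec_eventually hσ,
    eventually_eventually_nhds.2 h] with w h1 h2
  exact (isSec_pull_iff hn hi hQ hF).2 ⟨σ, h1, h2⟩

include hF in
theorem pairing_pullMap {v w : Q.Fiber (i z)} (hv : v ∈ Q.tangentSub E' i z)
    (hw : w ∈ Q.tangentSub E' i z) :
    (Q.pull hn hi hQ).pairing z (F z v) (F z w) = Q.pairing (i z) v w := by
  obtain ⟨u, rfl⟩ := exists_fibProd hv
  obtain ⟨t, rfl⟩ := exists_fibProd hw
  rw [hF, hF]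
  rfl

include hF in
theorem exists_lifts {s : ∀ z, Q.PullFiber E' i z} (hs : (Q.pull hn hi hQ).IsSec s z) :
    ∃ q, Q.Lifts E' i s z q := by
  obtain ⟨σ, hσ, h⟩ := (isSec_pull_iff hn hi hQ hF).1 hs
  obtain ⟨q, hq, hqσ⟩ := hQ.locallyFree.exists_extension hi.isImmersion hσ
  refine ⟨q, (lifts_iff hF).2 ⟨hq, ?_⟩⟩
  filter_upwards [h, hqσ] with w h1 h2
  rwa [h2] at h1

variable (hcon : IsLocallyConstant fun z => finrank 𝕂 (Q.conormalImage E' i z))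

include hF hcon in
theorem bracket_pull {s t : ∀ z, Q.PullFiber E' i z} {q p : ∀ x, Q.Fiber x}
    (hq : Q.Lifts E' i s z q) (hp : Q.Lifts E' i t z p) :
    Q.bracket q p (i z) ∈ Q.tangentSub E' i z ∧
      (Q.pull hn hi hQ).bracket s t z = F z (Q.bracket q p (i z)) := by
  have hn0 := order_ne_zero hn
  have hs := codiff_surjective_of_isSmoothEmbedding (𝕂 := 𝕂) hn hi
  have hT : ∀ {q p : ∀ x, Q.Fiber x}, Q.Lifts E' i s z q → Q.Lifts E' i t z p →
      Q.bracket q p (i z) ∈ Q.tangentSub E' i z := fun hq hp =>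
    bracket_mem_tangentSub hQ hn0 hi.isImmersion hs hq.1 hp.1
      (((lifts_iff hF).1 hq).2.mono fun _ h => h.1) (((lifts_iff hF).1 hp).2.mono fun _ h => h.1)
  refine ⟨hT hq hp, ?_⟩
  obtain ⟨u, hu⟩ := exists_fibProd (hT hq hp)
  -- The given lifts show that the predicate under `epsilon` is satisfiable, so its value comes from
  -- some lifts `q'`, `p'`. These differ from `q`, `p` by sections with restriction in `C`, which
  -- leaves the class of the bracket unchanged.
  have hspec : ∃ q p, Q.Lifts E' i s z q ∧ Q.Lifts E' i t z p ∧ ∃ u : Q.fibProd E' i z,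
      u.1.2 = Q.bracket q p (i z) ∧ (Q.pull hn hi hQ).bracket s t z = Q.pullMk E' i z u :=
    Classical.epsilon_spec (p := fun v : Q.PullFiber E' i z =>
      ∃ q p, Q.Lifts E' i s z q ∧ Q.Lifts E' i t z p ∧
        ∃ u : Q.fibProd E' i z, u.1.2 = Q.bracket q p (i z) ∧ v = Q.pullMk E' i z u)
      ⟨_, q, p, hq, hp, u, hu, rfl⟩
  obtain ⟨q', p', hq', hp', u', hu', he⟩ := hspec
  rw [he, ← hF, hu']
  refine sub_eq_zero.1 ((map_sub (F z) _ _).symm.trans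
    ((pullMap_eq_zero_iff hn hi hQ hF (Submodule.sub_mem _ (hT hq' hp') (hT hq hp))).2 ?_))
  have hdiff : ∀ {s : ∀ z, Q.PullFiber E' i z} {q q' : ∀ x, Q.Fiber x}, Q.Lifts E' i s z q →
      Q.Lifts E' i s z q' → ∀ᶠ w in 𝓝 z, q' (i w) - q (i w) ∈ Q.conormalImage E' i w := by
    intro s q q' hq hq'
    filter_upwards [((lifts_iff hF).1 hq).2, ((lifts_iff hF).1 hq').2] with w h1 h2
    rw [← pullMap_eq_zero_iff hn hi hQ hF (Submodule.sub_mem _ h2.1 h1.1), map_sub, ← h1.2, ← h2.2,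
      sub_self]
  exact bracket_sub_bracket_mem hQ hn0 hi.isImmersion hs hcon hq.1 hq'.1 hp.1 hp'.1
    (((lifts_iff hF).1 hq).2.mono fun _ h => h.1) (((lifts_iff hF).1 hp).2.mono fun _ h => h.1)
    (hdiff hq hq') (hdiff hp hp')

/-! #### Almost Dirac structures -/

theorem anchor_mem_range_diff_id (v : (Q.pull hn hi hQ).Fiber z) :
    (Q.pull hn hi hQ).anchor z v ∈ LinearMap.range (diff 𝕜 𝕂 E' E' (id : Z → Z) z) := by
  refine ⟨(Q.pull hn hi hQ).anchor z v, ?_⟩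
  have h : ∀ α : Cot 𝕜 𝕂 E' z, codiff 𝕜 𝕂 E' E' (id : Z → Z) z α = α := by
    intro α
    refine ContinuousLinearMap.ext fun w => ?_
    change (show E' →L[𝕜] 𝕂 from α) (mfderiv 𝓘(𝕜, E') 𝓘(𝕜, E') (id : Z → Z) z w) = _
    rw [mfderiv_id]
    rfl
  refine LinearMap.ext (M := Cot 𝕜 𝕂 E' z) (M₃ := 𝕂) fun α => ?_
  exact congrArg ((Q.pull hn hi hQ).anchor z v) (h α)

include hn hi hQ in
-- `L + C` is still isotropic: `C` is orthogonal to `T`, which contains both `L` and `C`.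
theorem conormalImage_le_of_maximal {L : Submodule 𝕂 (Q.Fiber (i z))}
    (hL : Maximal (fun L : Submodule 𝕂 (Q.Fiber (i z)) =>
      ∀ v ∈ L, ∀ w ∈ L, Q.pairing (i z) v w = 0) L)
    (hLT : L ≤ Q.tangentSub E' i z) : Q.conormalImage E' i z ≤ L := by
  have hs := codiff_surjective_of_isSmoothEmbedding (𝕂 := 𝕂) hn hi z
  refine le_trans le_sup_right (hL.2 (y := L ⊔ Q.conormalImage E' i z) ?_ le_sup_left)
  intro v hv w hw
  obtain ⟨v₁, hv₁, v₂, hv₂, rfl⟩ := Submodule.mem_sup.1 hv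
  obtain ⟨w₁, hw₁, w₂, hw₂, rfl⟩ := Submodule.mem_sup.1 hw
  have hC : ∀ v ∈ Q.tangentSub E' i z, ∀ w ∈ Q.conormalImage E' i z, Q.pairing (i z) v w = 0 :=
    fun v hv w hw => pairing_eq_zero_of_conormalImage hQ hs hv hw
  have hv₂T := conormalImage_le_tangentSub hQ z hv₂
  rw [LinearMap.map_add₂, map_add, map_add, hL.1 _ hv₁ _ hw₁, hC _ (hLT hv₁) _ hw₂,
    hQ.pairing_symm _ v₂ w₁, hC _ (hLT hw₁) _ hv₂, hC _ hv₂T _ hw₂]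
  simp

include hn hi hQ in
theorem IsAlmostDirac.conormalImage_le {K : ∀ z, Submodule 𝕂 (Q.Fiber (i z))}
    (hK : Q.IsAlmostDirac n E' i K) (z : Z) : Q.conormalImage E' i z ≤ K z :=
  conormalImage_le_of_maximal hn hi hQ (hK.maximal_isotropic z) (hK.le_tangentSub z)

include hn hi hQ hF in
/-- An almost Dirac structure is the inverse image of its image in `i^{++}Q`. -/
theorem IsAlmostDirac.tangentSub_inf_comap_pullSub {K : ∀ z, Submodule 𝕂 (Q.Fiber (i z))}
    (hK : Q.IsAlmostDirac n E' i K) (z : Z) :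
    Q.tangentSub E' i z ⊓ (Q.pullSub E' i K z).comap (F z) = K z := by
  have hKT := hK.le_tangentSub z
  rw [pullSub_eq_map hF hKT]
  refine le_antisymm ?_ (le_inf hKT (Submodule.le_comap_map _ _))
  rintro v ⟨hv, k, hk, hkv⟩
  have h1 : v - k ∈ Q.conormalImage E' i z := by
    rw [← pullMap_eq_zero_iff hn hi hQ hF (Submodule.sub_mem _ hv (hKT hk)), map_sub, hkv, sub_self]
  simpa using Submodule.add_mem _ (hK.conormalImage_le hn hi hQ z h1) hk

variable (hfib : IsLocallyConstant fun z => finrank 𝕂 (Q.fibProd E' i z))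

include hF hfib hcon in
theorem IsAlmostDirac.pullSub {K : ∀ z, Submodule 𝕂 (Q.Fiber (i z))}
    (hK : Q.IsAlmostDirac n E' i K) :
    (Q.pull hn hi hQ).IsAlmostDirac n E' id (Q.pullSub E' i K) where
  subbundle := by
    have hn0 := order_ne_zero hn
    have hs := codiff_surjective_of_isSmoothEmbedding (𝕂 := 𝕂) hn hi
    have h := (isSubquotient_pull hn hi hQ hF).isSubbundle_map
      (hQ.locallyFree.pullback hi.contMDiff)
      (isRegularAt_tangentSub hQ hn0 hi.isImmersion hs hfib)
      (isRegularAt_conormalImage hQ hn0 hi.isImmersion hcon) hK.subbundle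
      (hK.conormalImage_le hn hi hQ) (hK.le_tangentSub)
    rwa [show Q.pullSub E' i K = fun z => (K z).map (F z) from
      funext fun z => pullSub_eq_map hF (hK.le_tangentSub z)]
  maximal_isotropic z := by
    have hKT := hK.le_tangentSub z
    rw [pullSub_eq_map hF hKT]
    constructor
    · rintro _ ⟨v, hv, rfl⟩ _ ⟨w, hw, rfl⟩
      exact (pairing_pullMap hn hi hQ hF (hKT hv) (hKT hw)).trans
        ((hK.maximal_isotropic z).1 v hv w hw)
    · intro L hL hKL t ht
      obtain ⟨v, hv, rfl⟩ := (hF z).exists_eq t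
      let L' : Submodule 𝕂 (Q.PullFiber E' i z) := L
      -- Maximality downstairs: the preimage in `T` of an isotropic `L` is isotropic and contains
      -- `K`, hence equals it.
      have h1 : Q.tangentSub E' i z ⊓ L'.comap (F z) ≤ K z := by
        refine (hK.maximal_isotropic z).2 (fun a ha b hb => ?_)
          (le_inf hKT (Submodule.map_le_iff_le_comap.1 hKL))
        exact (pairing_pullMap hn hi hQ hF ha.1 hb.1).symm.trans (hL _ ha.2 _ hb.2)
      exact ⟨v, h1 ⟨hv, ht⟩, rfl⟩
  anchor_mem z v _ := anchor_mem_range_diff_id hn hi hQ v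

include hF hcon in
theorem isAlmostDirac_of_pull {D : ∀ z, Submodule 𝕂 (Q.PullFiber E' i z)}
    (hD : (Q.pull hn hi hQ).IsAlmostDirac n E' id D) :
    Q.IsAlmostDirac n E' i fun z => Q.tangentSub E' i z ⊓ (D z).comap (F z) where
  subbundle := (isSubquotient_pull hn hi hQ hF).isSubbundle_comap
    (hQ.locallyFree.pullback hi.contMDiff)
    (isRegularAt_conormalImage hQ (order_ne_zero hn) hi.isImmersion hcon) hD.subbundle
  maximal_isotropic z := by
    have hs := codiff_surjective_of_isSmoothEmbedding (𝕂 := 𝕂) hn hi z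
    constructor
    · intro v hv w hw
      exact (pairing_pullMap hn hi hQ hF hv.1 hw.1).symm.trans
        ((hD.maximal_isotropic z).1 _ hv.2 _ hw.2)
    · intro L hL hDL
      have hCL : Q.conormalImage E' i z ≤ L := fun v hv => hDL ⟨conormalImage_le_tangentSub hQ z hv,
        by
          have h1 := (pullMap_eq_zero_iff hn hi hQ hF (conormalImage_le_tangentSub hQ z hv)).2 hv
          rw [SetLike.mem_coe, Submodule.mem_comap, h1]
          exact Submodule.zero_mem _⟩
      -- An isotropic `L` containing `C` lies in the orthogonal of `C`, which is `T`. Thus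
      -- maximality, tested against all isotropic subspaces of the fibre, reduces to subspaces of
      -- `T`, hence to `T / C`.
      have hLT : L ≤ Q.tangentSub E' i z := by
        intro v hv
        rw [mem_tangentSub_iff hs]
        intro α hα
        rw [← hQ.pairing_coanchor]
        exact hL v hv _ (hCL ⟨α, hα, rfl⟩)
      have h1 : L.map (F z) ≤ D z := by
        refine (hD.maximal_isotropic z).2 ?_ ?_
        · rintro _ ⟨v, hv, rfl⟩ _ ⟨w, hw, rfl⟩
          exact (pairing_pullMap hn hi hQ hF (hLT hv) (hLT hw)).trans (hL v hv w hw)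
        · intro t ht
          obtain ⟨v, hv, rfl⟩ := (hF z).exists_eq t
          exact ⟨v, hDL ⟨hv, ht⟩, rfl⟩
      exact le_inf hLT (Submodule.map_le_iff_le_comap.1 h1)
  anchor_mem z v hv := hv.1

/-! #### Dirac structures -/

include hF hfib hcon in
theorem IsDirac.pullSub {K : ∀ z, Submodule 𝕂 (Q.Fiber (i z))} (hK : Q.IsDirac n E' i K) :
    (Q.pull hn hi hQ).IsDirac n E' id (Q.pullSub E' i K) := by
  have hA := hK.toIsAlmostDirac
  have hKl := ((isDirac_iff_local (fun x s hs => hQ.locallyFree.isSec_eventually hs)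
    hi.isEmbedding).1 hK).2
  refine (isDirac_iff_local (fun z s hs => isSec_pull_eventually hn hi hQ hF hs) .id).2
    ⟨hA.pullSub hn hi hQ hF hcon hfib, fun z s t hs ht hsK htK => ?_⟩
  obtain ⟨q, hq⟩ := exists_lifts hn hi hQ hF hs
  obtain ⟨p, hp⟩ := exists_lifts hn hi hQ hF ht
  -- Since `K` is the full preimage of its image, any lift of a section of `K / C` has restriction
  -- in `K`.
  have hmem : ∀ {s : ∀ z, Q.PullFiber E' i z} {q : ∀ x, Q.Fiber x}, Q.Lifts E' i s z q →
      (∀ᶠ w in 𝓝 z, s w ∈ Q.pullSub E' i K w) → ∀ᶠ w in 𝓝 z, q (i w) ∈ K w := by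
    intro s q hq hs
    filter_upwards [((lifts_iff hF).1 hq).2, hs] with w h1 h2
    rw [← hA.tangentSub_inf_comap_pullSub hn hi hQ hF w]
    exact ⟨h1.1, by rwa [h1.2] at h2⟩
  have h1 := hKl z q p hq.1 hp.1 (hmem hq hsK) (hmem hp htK)
  rw [← hA.tangentSub_inf_comap_pullSub hn hi hQ hF z] at h1
  have h2 := (bracket_pull hn hi hQ hF hcon hq hp).2
  exact Set.mem_of_eq_of_mem h2 h1.2

include hF hcon in
theorem isDirac_of_pull {D : ∀ z, Submodule 𝕂 (Q.PullFiber E' i z)}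
    (hD : (Q.pull hn hi hQ).IsDirac n E' id D) :
    Q.IsDirac n E' i fun z => Q.tangentSub E' i z ⊓ (D z).comap (F z) := by
  have hDl := ((isDirac_iff_local (fun z s hs => isSec_pull_eventually hn hi hQ hF hs) .id).1 hD).2
  refine (isDirac_iff_local (fun x s hs => hQ.locallyFree.isSec_eventually hs)
    hi.isEmbedding).2 ⟨isAlmostDirac_of_pull hn hi hQ hF hcon hD.toIsAlmostDirac,
      fun z q p hq hp hqK hpK => ?_⟩
  have hlift : ∀ {q : ∀ x, Q.Fiber x}, Q.IsSec q (i z) →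
      (∀ᶠ w in 𝓝 z, q (i w) ∈ Q.tangentSub E' i w ⊓ (D w).comap (F w)) →
      Q.Lifts E' i (fun w => F w (q (i w))) z q ∧
        (Q.pull hn hi hQ).IsSec (fun w => F w (q (i w))) z := by
    intro q hq hqK
    exact ⟨(lifts_iff hF).2 ⟨hq, hqK.mono fun w hw => ⟨hw.1, rfl⟩⟩, (isSec_pull_iff hn hi hQ hF).2
      ⟨_, ModFamily.isSec_pullback_comp hq, hqK.mono fun w hw => ⟨hw.1, rfl⟩⟩⟩
  have h1 := hDl z _ _ (hlift hq hqK).2 (hlift hp hpK).2 (hqK.mono fun w hw => hw.2)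
    (hpK.mono fun w hw => hw.2)
  obtain ⟨h2, h3⟩ := bracket_pull hn hi hQ hF hcon (hlift hq hqK).1 (hlift hp hpK).1
  refine ⟨h2, ?_⟩
  change F z _ ∈ D z
  rw [← h3]
  exact h1

end Pull

end CourantOps

end CourantDirac

end

/-! ### The proposition -/

theorem mainTheorem5
    {𝕜 : Type*} [RCLike 𝕜] {𝕂 : Type*} [RCLike 𝕂] [NormedAlgebra 𝕜 𝕂]
    {n : WithTop ℕ∞} (hn : ∞ ≤ n)
    {E : Type*} [NormedAddCommGroup E] [NormedSpace 𝕜 E] [FiniteDimensional 𝕜 E]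
    {X : Type*} [TopologicalSpace X] [ChartedSpace E X] [IsManifold 𝓘(𝕜, E) n X]
    {E' : Type*} [NormedAddCommGroup E'] [NormedSpace 𝕜 E'] [FiniteDimensional 𝕜 E']
    {Z : Type*} [TopologicalSpace Z] [ChartedSpace E' Z] [IsManifold 𝓘(𝕜, E') n Z]
    {i : Z → X} (hi : Manifold.IsSmoothEmbedding 𝓘(𝕜, E') 𝓘(𝕜, E) n i)
    (Q : CourantDirac.CourantOps 𝕜 𝕂 E X) (hQ : Q.IsCourant n)
    (hfib : IsLocallyConstant fun z => finrank 𝕂 (Q.fibProd E' i z))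
    (hcon : IsLocallyConstant fun z => finrank 𝕂 (Q.conormalImage E' i z)) :
    (∀ K, Q.IsDirac n E' i K →
      (∀ z, Q.conormalImage E' i z ≤ K z) ∧
      (Q.pull hn hi hQ).IsDirac n E' id (Q.pullSub E' i K)) ∧
    Set.BijOn (Q.pullSub E' i)
      {K | Q.IsDirac n E' i K} {D | (Q.pull hn hi hQ).IsDirac n E' id D} ∧
    Set.BijOn (Q.pullSub E' i)
      {K | Q.IsAlmostDirac n E' i K} {D | (Q.pull hn hi hQ).IsAlmostDirac n E' id D} := by
  choose F hF using fun z => CourantDirac.CourantOps.exists_isPullMap (Q := Q)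
    (CourantDirac.CourantOps.codiff_surjective_of_isSmoothEmbedding (𝕂 := 𝕂) hn hi z)
  -- `K` is recovered as the preimage in `T` of its image; this covers Dirac structures too.
  have hinj : Set.InjOn (Q.pullSub E' i) {K | Q.IsAlmostDirac n E' i K} := by
    intro K hK K' hK' h
    funext z
    rw [← hK.tangentSub_inf_comap_pullSub hn hi hQ hF z, h,
      hK'.tangentSub_inf_comap_pullSub hn hi hQ hF z]
  refine ⟨fun K hK => ⟨hK.toIsAlmostDirac.conormalImage_le hn hi hQ,
    hK.pullSub hn hi hQ hF hcon hfib⟩, ⟨fun K hK => hK.pullSub hn hi hQ hF hcon hfib,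
    hinj.mono fun K hK => hK.toIsAlmostDirac, fun D hD => ?_⟩,
    ⟨fun K hK => hK.pullSub hn hi hQ hF hcon hfib, hinj, fun D hD => ?_⟩⟩
  · exact ⟨_, CourantDirac.CourantOps.isDirac_of_pull hn hi hQ hF hcon hD,
      CourantDirac.CourantOps.pullSub_tangentSub_inf_comap hF D⟩
  · exact ⟨_, CourantDirac.CourantOps.isAlmostDirac_of_pull hn hi hQ hF hcon hD,
      CourantDirac.CourantOps.pullSub_tangentSub_inf_comap hF D⟩
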